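/- Let $n \ge 5$ and let $N = \{1,\dots,n\}$ be a set of agents. An instance is a profile $\vec{x} = (x_1,\dots,x_n) \in \mathbb{R}^n$ of agent locations on the real line. A (deterministic) mechanism $F$ for 2-Facility Location maps every instance $\vec{x} \in \mathbb{R}^n$ to a pair $F(\vec{x}) = (F_1(\vec{x}), F_2(\vec{x}))$ of facility locations with $F_1(\vec{x}) \le F_2(\vec{x})$; we write $y \in F(\vec{x})$ if $y = F_1(\vec{x})$ or $y = F_2(\vec{x})$. The cost of an agent at $a \in \mathbb{R}$ for facilities $(y_1, y_2)$ is $\mathrm{cost}[a, (y_1,y_2)] = \min\{|a-y_1|, |a-y_2|\}$, and the social cost of $(y_1,y_2)$ for $\vec{x}$ is $\sum_{i=1}^n \mathrm{cost}[x_i, (y_1,y_2)]$. The mechanism $F$ is nice if (a) it is strategyproof: for all instances $\vec{x}$, all agents $i$ and all $y \in \mathbb{R}$, $\mathrm{cost}[x_i, F(\vec{x})] \le \mathrm{cost}[x_i, F(\vec{x}_{-i}, y)]$, where $(\vec{x}_{-i}, y)$ is $\vec{x}$ with $x_i$ replaced by $y$; and (b) it has a bounded approximation ratio: there is a constant $\rho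 \ge 1$ such that for every instance $\vec{x}$ the social cost of $F(\vec{x})$ is at most $\rho$ times the minimum social cost of a pair $(y_1,y_2) \in \mathbb{R}^2$ for $\vec{x}$. Let $\mathcal{I}^3(N)$ be the set of 3-location instances, i.e. the instances in which the agents occupy exactly three different locations. Theorem. Let $F$ be a nice mechanism for 2-Facility Location with $n \ge 5$ agents. Then either there exists a unique agent $j \in N$ (the dictator) such that $x_j \in F(\vec{x})$ for all $\vec{x} \in \mathcal{I}^3(N)$, or $F(\vec{x}) = (\min \vec{x}, \max \vec{x})$ for all $\vec{x} \in \mathcal{I}^3(N)$. -/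

import Mathlib

namespace FacilityLocation

/-- An instance (locations profile): agent `i` is located at `x i` on the real line. -/
abbrev Instance (n : ℕ) : Type := Fin n → ℝ

/-- A deterministic mechanism for 2-Facility Location with `n` agents: it maps every locations
profile to a pair of facility locations, the leftmost one first. -/
structure Mechanism (n : ℕ) where
  /-- The pair of facilities placed for an instance. -/
  outcome : Instance n → ℝ × ℝ
  /-- The facilities are listed from left to right. -/
  ordered : ∀ x, (outcome x).1 ≤ (outcome x).2

/-- There is a facility at `a` in the pair of facilities `y`. -/
def HasFacilityAt (y : ℝ × ℝ) (a : ℝ) : Prop := a = y.1 ∨ a = y.2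

/-- The cost of an agent at location `a`: the distance to the nearest facility. -/
noncomputable def agentCost (a : ℝ) (y : ℝ × ℝ) : ℝ := min |a - y.1| |a - y.2|

/-- The social cost: the sum of the agents' costs. -/
noncomputable def socialCost {n : ℕ} (x : Instance n) (y : ℝ × ℝ) : ℝ :=
  ∑ i, agentCost (x i) y

/-- The optimal social cost over all pairs of facility locations. The infimum is over
nonnegative reals, and it is attained. -/
noncomputable def optimalCost {n : ℕ} (x : Instance n) : ℝ :=
  ⨅ y : ℝ × ℝ, socialCost x y

/-- The mechanism `F` has approximation ratio `ρ ≥ 1` for the social cost. -/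
def HasApproxRatio {n : ℕ} (F : Mechanism n) (ρ : ℝ) : Prop :=
  1 ≤ ρ ∧ ∀ x : Instance n, socialCost x (F.outcome x) ≤ ρ * optimalCost x

/-- No agent can decrease her cost by misreporting her location. -/
def Strategyproof {n : ℕ} (F : Mechanism n) : Prop :=
  ∀ (x : Instance n) (i : Fin n) (y : ℝ),
    agentCost (x i) (F.outcome x) ≤ agentCost (x i) (F.outcome (Function.update x i y))

/-- A (deterministic) mechanism is nice if it is strategyproof and has a bounded approximation
ratio; for the fixed set of agents the bound is a constant. -/
def Nice {n : ℕ} (F : Mechanism n) : Prop :=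
  Strategyproof F ∧ ∃ ρ : ℝ, HasApproxRatio F ρ

/-- The set of 3-location instances: the agents occupy exactly three different locations
`a`, `b`, `c`, i.e. they are partitioned into three nonempty coalitions, one at each of them. -/
def threeLocationInstances (n : ℕ) : Set (Instance n) :=
  {x | ∃ a b c : ℝ, a ≠ b ∧ a ≠ c ∧ b ≠ c ∧ Set.range x = {a, b, c}}

end FacilityLocation

namespace FacilityLocation

/-! Agents at one location cannot gain by lying jointly, so every partition into three nonempty
coalitions induces a strategyproof mechanism for three agents. With the other reports fixed, an
agent's cost is her distance to the closed set of locations she can obtain. Bounded approximation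
forces facilities wherever two of three agents meet, which anchors these sets; the arguments then
examine the ends of their holes.

If agents 1 and 2 are close together and far from 3, one facility lies between them, and they play a
strategyproof one-facility game in which right-preferred locations never exceed left-preferred ones
(`LocalGame.le_of_preferred`). A location preferred by both is impossible, because agent 3 could
also claim it (`not_preferred`). Hence a hole of the middle agent must fill the whole gap between
the outer agents: she is always served, or the facilities are always at the extremes
(`hasFacilityAt_middle`, `eq_extremes`). Two orders differing by an exchange of neighbours cannot
both serve the middle (`not_middleServed_swap₂₃`, `not_middleServed_swap₁₂`).

Partitions are compared through four coalitions: a served middle coalition can be split so that one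
part joins its outer neighbour and the other part is still served (`IsNiceFour.not_middleServed`).
Repeated splitting reaches a single agent. Since swapped orders are excluded, the other agents may
change sides, so she is served in the middle of every partition. When she is at an end, the middle
cannot be served, so the extremes are, and she is at one of them. -/

lemma agentCost_nonneg (a : ℝ) (y : ℝ × ℝ) : 0 ≤ agentCost a y :=
  le_min (abs_nonneg _) (abs_nonneg _)

lemma agentCost_le_iff {a t : ℝ} {y : ℝ × ℝ} :
    agentCost a y ≤ t ↔ |a - y.1| ≤ t ∨ |a - y.2| ≤ t := min_le_iff

lemma le_agentCost_iff {a t : ℝ} {y : ℝ × ℝ} :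
    t ≤ agentCost a y ↔ t ≤ |a - y.1| ∧ t ≤ |a - y.2| := le_min_iff

lemma HasFacilityAt.agentCost_le {y : ℝ × ℝ} {z : ℝ} (h : HasFacilityAt y z) (a : ℝ) :
    agentCost a y ≤ |a - z| := by
  rcases h with rfl | rfl
  · exact min_le_left _ _
  · exact min_le_right _ _

lemma agentCost_eq_zero_iff {a : ℝ} {y : ℝ × ℝ} : agentCost a y = 0 ↔ HasFacilityAt y a := by
  constructor
  · intro h
    rcases agentCost_le_iff.1 h.le with h | h
    · exact Or.inl (sub_eq_zero.1 (abs_nonpos_iff.1 h))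
    · exact Or.inr (sub_eq_zero.1 (abs_nonpos_iff.1 h))
  · intro h
    refine le_antisymm ?_ (agentCost_nonneg _ _)
    simpa using h.agentCost_le a

lemma hasFacilityAt_of_agentCost_le_zero {a : ℝ} {y : ℝ × ℝ} (h : agentCost a y ≤ 0) :
    HasFacilityAt y a :=
  agentCost_eq_zero_iff.1 (le_antisymm h (agentCost_nonneg _ _))

/-- A location with a facility realizing the cost of an agent at `a`. -/
lemma exists_hasFacilityAt_abs_le {a t : ℝ} {y : ℝ × ℝ} (h : agentCost a y ≤ t) :
    ∃ z, HasFacilityAt y z ∧ |a - z| ≤ t := by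
  rcases agentCost_le_iff.1 h with h | h
  · exact ⟨_, Or.inl rfl, h⟩
  · exact ⟨_, Or.inr rfl, h⟩

/-! ### What a single agent can obtain -/

/-- The outcomes as a function of the report of a single agent, who cannot profit from lying. -/
def IsTruthfulCurve (f : ℝ → ℝ × ℝ) : Prop :=
  ∀ x x', agentCost x (f x) ≤ agentCost x (f x')

namespace IsTruthfulCurve

variable {f : ℝ → ℝ × ℝ}

lemma cost_le (hf : IsTruthfulCurve f) {x' z : ℝ} (h : HasFacilityAt (f x') z) (x : ℝ) :
    agentCost x (f x) ≤ |x - z| :=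
  (hf x x').trans (h.agentCost_le x)

/-- The recurring move: an agent walks to an existing facility and keeps it there, as her truthful
cost at `y` cannot exceed that of the report `x`. -/
lemma hasFacilityAt_self (hf : IsTruthfulCurve f) {x y : ℝ} (h : HasFacilityAt (f x) y) :
    HasFacilityAt (f y) y :=
  hasFacilityAt_of_agentCost_le_zero (by simpa using hf.cost_le h y)

lemma isClosed_image (hf : IsTruthfulCurve f) : IsClosed {x | HasFacilityAt (f x) x} := by
  have hlip : LipschitzWith 1 fun x => agentCost x (f x) := by
    refine LipschitzWith.of_le_add fun x y => ?_
    obtain ⟨z, hz, hzy⟩ := exists_hasFacilityAt_abs_le (le_refl (agentCost y (f y)))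
    have h1 := hf.cost_le hz x
    have h2 := abs_sub_le x y z
    rw [Real.dist_eq]
    linarith
  have : {x | HasFacilityAt (f x) x} = (fun x => agentCost x (f x)) ⁻¹' {0} := by
    ext x
    simp [agentCost_eq_zero_iff]
  rw [this]
  exact isClosed_singleton.preimage hlip.continuous

/-- A location that the agent cannot obtain lies in a hole of the set of obtainable ones, and the
agent is served by the nearest end of the hole. -/
lemma exists_hole (hf : IsTruthfulCurve f) {l₀ r₀ m : ℝ} (hl₀ : HasFacilityAt (f l₀) l₀)
    (hr₀ : HasFacilityAt (f r₀) r₀) (hlm : l₀ ≤ m) (hmr : m ≤ r₀)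
    (hm : ¬ HasFacilityAt (f m) m) :
    ∃ l r, l₀ ≤ l ∧ l < m ∧ m < r ∧ r ≤ r₀ ∧
      (∀ x, l < x → x < r → ¬ HasFacilityAt (f x) x) ∧
      (∀ x, l < x → x < (l + r) / 2 → HasFacilityAt (f x) l) ∧
      (∀ x, (l + r) / 2 < x → x < r → HasFacilityAt (f x) r) := by
  set I := {x | HasFacilityAt (f x) x} with hI
  have hcl : IsClosed I := hf.isClosed_image
  have hL : sSup (I ∩ Set.Icc l₀ m) ∈ I ∩ Set.Icc l₀ m :=
    (isCompact_Icc.inter_left hcl).sSup_mem ⟨l₀, hl₀, le_rfl, hlm⟩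
  have hR : sInf (I ∩ Set.Icc m r₀) ∈ I ∩ Set.Icc m r₀ :=
    (isCompact_Icc.inter_left hcl).sInf_mem ⟨r₀, hr₀, hmr, le_rfl⟩
  have hLu : ∀ x ∈ I ∩ Set.Icc l₀ m, x ≤ sSup (I ∩ Set.Icc l₀ m) := fun x hx =>
    le_csSup (isCompact_Icc.inter_left hcl).bddAbove hx
  have hRu : ∀ x ∈ I ∩ Set.Icc m r₀, sInf (I ∩ Set.Icc m r₀) ≤ x := fun x hx =>
    csInf_le (isCompact_Icc.inter_left hcl).bddBelow hx
  generalize sSup (I ∩ Set.Icc l₀ m) = l at hL hLu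
  generalize sInf (I ∩ Set.Icc m r₀) = r at hR hRu
  have hlm' : l < m := lt_of_le_of_ne hL.2.2 fun h => hm (h ▸ hL.1)
  have hmr' : m < r := lt_of_le_of_ne hR.2.1 fun h => hm (h ▸ hR.1)
  have hhole : ∀ x, l < x → x < r → x ∉ I := by
    intro x h1 h2 hx
    rcases le_total x m with h | h
    · exact absurd (hLu x ⟨hx, hL.2.1.trans h1.le, h⟩) (not_le.2 h1)
    · exact absurd (hRu x ⟨hx, h, h2.le.trans hR.2.2⟩) (not_le.2 h2)
  refine ⟨l, r, hL.2.1, hlm', hmr', hR.2.2, hhole, ?_, ?_⟩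
  -- Some facility is within `x - l` of `x`, and facilities are at obtainable locations; left of the
  -- midpoint the only one in reach is `l`.
  · intro x h1 h2
    obtain ⟨z, hz, hzx⟩ := exists_hasFacilityAt_abs_le (hf.cost_le hL.1 x)
    rw [abs_of_pos (sub_pos.2 h1), abs_le] at hzx
    have hzI : z ∈ I := hf.hasFacilityAt_self hz
    have : z = l := by
      by_contra hne
      exact hhole z (lt_of_le_of_ne (by linarith) (Ne.symm hne)) (by linarith) hzI
    exact this ▸ hz
  · intro x h1 h2
    obtain ⟨z, hz, hzx⟩ := exists_hasFacilityAt_abs_le (hf.cost_le hR.1 x)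
    rw [abs_of_neg (sub_neg.2 h2), abs_le] at hzx
    have hzI : z ∈ I := hf.hasFacilityAt_self hz
    have : z = r := by
      by_contra hne
      exact hhole z (by linarith) (lt_of_le_of_ne (by linarith) hne) hzI
    exact this ▸ hz

end IsTruthfulCurve

/-! ### Two agents sharing one facility -/

/-- Induction along a real interval in steps of bounded length. -/
lemma step_induction {P : ℝ → Prop} {l r δ : ℝ} (hδ : 0 < δ) (h0 : P l)
    (step : ∀ s s', l ≤ s → s ≤ s' → s' ≤ r → s' ≤ s + δ → P s → P s') {s : ℝ}
    (hls : l ≤ s) (hsr : s ≤ r) : P s := by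
  have key : ∀ (k : ℕ) (s : ℝ), l ≤ s → s ≤ r → s ≤ l + k * δ → P s := by
    intro k
    induction k with
    | zero =>
      intro s h1 _ h3
      have : s = l := le_antisymm (by simpa using h3) h1
      exact this ▸ h0
    | succ k ih =>
      intro s h1 h2 h3
      push_cast at h3
      have hk : 0 ≤ (k : ℝ) * δ := by positivity
      refine step (max l (s - δ)) s (le_max_left _ _) (max_le h1 (by linarith)) h2
        (by linarith [le_max_right l (s - δ)]) (ih _ (le_max_left _ _)
          (max_le (h1.trans h2) (by linarith)) (max_le (by linarith) (by linarith)))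
  obtain ⟨k, hk⟩ := exists_nat_ge ((s - l) / δ)
  refine key k s hls hsr ?_
  rw [div_le_iff₀ hδ] at hk
  linarith

/-- Two nearby locations `x ≤ y`, which are well separated from a location `e` on their right. -/
def WellSeparated (κ e x y : ℝ) : Prop := x ≤ y ∧ y < e ∧ κ * (y - x) < e - y

lemma WellSeparated.mono {κ e x y x' y' : ℝ} (hκ : 0 ≤ κ) (h : WellSeparated κ e x y)
    (h1 : x ≤ x') (h2 : x' ≤ y') (h3 : y' ≤ y) : WellSeparated κ e x' y' := by
  obtain ⟨_, h5, h6⟩ := h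
  refine ⟨h2, by linarith, ?_⟩
  have : κ * (y' - x') ≤ κ * (y - x) := mul_le_mul_of_nonneg_left (by linarith) hκ
  linarith

/-- Supplies a uniform step length `δ`: the width `2 * δ` leaves room for one step of the induction
and a margin of the same size. -/
lemma wellSeparated_of_le {κ e b δ x y : ℝ} (hκ : 0 ≤ κ) (hδ : (2 * κ + 1) * δ ≤ e - b)
    (hb : b < e) (hxy : x ≤ y) (hyb : y ≤ b) (hd : y - x ≤ 2 * δ) : WellSeparated κ e x y := by
  refine ⟨hxy, by linarith, ?_⟩
  have h1 : κ * (y - x) ≤ κ * (2 * δ) := mul_le_mul_of_nonneg_left hd hκ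
  rcases le_or_gt δ 0 with h | h
  · have : κ * (2 * δ) ≤ 0 := mul_nonpos_of_nonneg_of_nonpos hκ (by linarith)
    linarith
  · nlinarith

/-- A strategyproof location of one facility for two agents at `x ≤ y`, between them, as long as
they are well separated from `e`. -/
structure LocalGame (κ e : ℝ) (u : ℝ → ℝ → ℝ) : Prop where
  nonneg : 0 ≤ κ
  mem : ∀ {x y}, WellSeparated κ e x y → x ≤ u x y ∧ u x y ≤ y
  sp_left : ∀ {x x' y}, WellSeparated κ e x y → WellSeparated κ e x' y →
    u x y - x ≤ |u x' y - x|
  sp_right : ∀ {x y y'}, WellSeparated κ e x y → WellSeparated κ e x y' →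
    y - u x y ≤ |y - u x y'|

/-- The right agent obtains the facility at `l`. -/
def RightPreferred (κ e : ℝ) (u : ℝ → ℝ → ℝ) (l : ℝ) : Prop :=
  ∃ a < l, WellSeparated κ e a l ∧ u a l = l

/-- The left agent obtains the facility at `l`. -/
def LeftPreferred (κ e : ℝ) (u : ℝ → ℝ → ℝ) (l : ℝ) : Prop :=
  ∃ b > l, WellSeparated κ e l b ∧ u l b = l

namespace LocalGame

variable {κ e : ℝ} {u : ℝ → ℝ → ℝ}

lemma eq_right_of_le (hu : LocalGame κ e u) {x x' y : ℝ} (h : u x y = y) (hx : x ≤ x')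
    (hy : x' ≤ y) (hw : WellSeparated κ e x y) : u x' y = y := by
  have hw' : WellSeparated κ e x' y := hw.mono hu.nonneg hx hy le_rfl
  have h1 := hu.sp_left hw hw'
  have h2 := hu.mem hw'
  rw [h, abs_of_nonneg (by linarith)] at h1
  linarith

/-- The left agent retreats in steps shorter than her distance to `y`. A facility leaving `y` would,
by truthfulness at her old location, have to be at least that distance to its left, beyond her new
location. -/
lemma eq_right_of_ge (hu : LocalGame κ e u) {x x' y : ℝ} (h : u x y = y) (hxy : x < y)
    (hx : x' ≤ x) (hw : WellSeparated κ e x' y) : u x' y = y := by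
  have key : u (x - (x - x')) y = y := by
    refine step_induction (P := fun t => u (x - t) y = y) (l := 0) (r := x - x')
      (δ := (y - x) / 2) (by linarith) (by simpa using h) ?_ (by linarith) le_rfl
    intro s s' h0 h1 h2 h3 h4
    by_contra hne
    have hws : WellSeparated κ e (x - s) y :=
      hw.mono hu.nonneg (by linarith) (by linarith) le_rfl
    have hws' : WellSeparated κ e (x - s') y :=
      hw.mono hu.nonneg (by linarith) (by linarith) le_rfl
    have h5 := hu.mem hws'
    have h6 : u (x - s') y < y := lt_of_le_of_ne h5.2 hne
    have h7 := hu.sp_left hws hws'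
    rw [h4] at h7
    rcases le_abs.1 h7 with h | h <;> linarith
  simpa using key

lemma eq_left_of_le (hu : LocalGame κ e u) {x y y' : ℝ} (h : u x y = x) (hy : y' ≤ y)
    (hx : x ≤ y') (hw : WellSeparated κ e x y) : u x y' = x := by
  have hw' : WellSeparated κ e x y' := hw.mono hu.nonneg le_rfl hx hy
  have h1 := hu.sp_right hw hw'
  have h2 := hu.mem hw'
  rw [h, abs_of_nonneg (by linarith)] at h1
  linarith

lemma eq_left_of_ge (hu : LocalGame κ e u) {x y y' : ℝ} (h : u x y = x) (hxy : x < y)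
    (hy : y ≤ y') (hw : WellSeparated κ e x y') : u x y' = x := by
  refine step_induction (P := fun t => u x t = x) (l := y) (r := y')
      (δ := (y - x) / 2) (by linarith) h ?_ hy le_rfl
  intro s s' h0 h1 h2 h3 h4
  by_contra hne
  have hws : WellSeparated κ e x s :=
    hw.mono hu.nonneg le_rfl (by linarith) (by linarith)
  have hws' : WellSeparated κ e x s' :=
    hw.mono hu.nonneg le_rfl (by linarith) (by linarith)
  have h5 := hu.mem hws'
  have h6 : x < u x s' := lt_of_le_of_ne h5.1 (Ne.symm hne)
  have h7 := hu.sp_right hws hws'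
  rw [h4] at h7
  rcases le_abs.1 h7 with h | h <;> linarith

lemma eq_right_of_rightPreferred (hu : LocalGame κ e u) {a l : ℝ} (h : RightPreferred κ e u l)
    (hw : WellSeparated κ e a l) : u a l = l := by
  obtain ⟨a₀, h1, h2, h3⟩ := h
  rcases le_total a a₀ with h | h
  · exact hu.eq_right_of_ge h3 h1 h hw
  · exact hu.eq_right_of_le h3 h hw.1 h2

lemma eq_left_of_leftPreferred (hu : LocalGame κ e u) {b l : ℝ} (h : LeftPreferred κ e u l)
    (hw : WellSeparated κ e l b) : u l b = l := by
  obtain ⟨b₀, h1, h2, h3⟩ := h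
  rcases le_total b b₀ with h | h
  · exact hu.eq_left_of_le h3 h hw.1 h2
  · exact hu.eq_left_of_ge h3 h1 h hw

lemma rightPreferred_apply (hu : LocalGame κ e u) {a b : ℝ} (hw : WellSeparated κ e a b)
    (h : a < u a b) : RightPreferred κ e u (u a b) := by
  have hw' := hw.mono hu.nonneg le_rfl h.le (hu.mem hw).2
  refine ⟨a, h, hw', le_antisymm (hu.mem hw').2 ?_⟩
  have := hu.sp_right hw' hw
  rw [sub_self, abs_zero] at this
  linarith

lemma leftPreferred_apply (hu : LocalGame κ e u) {a b : ℝ} (hw : WellSeparated κ e a b)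
    (h : u a b < b) : LeftPreferred κ e u (u a b) := by
  have hw' := hw.mono hu.nonneg (hu.mem hw).1 h.le le_rfl
  refine ⟨b, h, hw', le_antisymm ?_ (hu.mem hw').1⟩
  have := hu.sp_left hw' hw
  rw [sub_self, abs_zero] at this
  linarith

/-- The location preferred by the right agent lies on the left of those preferred by the left
agent. -/
lemma le_of_preferred (hu : LocalGame κ e u) {l₀ l : ℝ} (hl : RightPreferred κ e u l)
    (hl₀ : LeftPreferred κ e u l₀) : l ≤ l₀ := by
  by_contra! hlt
  obtain ⟨a₀, ha₀, hwa, hua⟩ := id hl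
  have hκ := hu.nonneg
  have hle : l < e := hwa.2.1
  set s₁ := max l₀ a₀ with hs₁
  have hs₁l : s₁ < l := max_lt hlt ha₀
  have hw₁ : WellSeparated κ e s₁ l := hwa.mono hκ (le_max_right _ _) hs₁l.le le_rfl
  set δ := min (l - s₁) ((e - l) / (2 * κ + 1)) with hδ
  have hδ0 : 0 < δ := lt_min (by linarith) (div_pos (by linarith) (by linarith))
  have hδ1 : δ ≤ l - s₁ := min_le_left _ _
  have hδ2 : (2 * κ + 1) * δ ≤ e - l := by
    have := min_le_right (l - s₁) ((e - l) / (2 * κ + 1))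
    rw [← hδ, le_div_iff₀ (by linarith)] at this
    linarith
  -- Left preference spreads to the right: a facility strictly beyond `s'` for the pair `s'`, `s' +
  -- δ` would be right-preferred, and paired with `s` it would have to be at both ends.
  have key : LeftPreferred κ e u s₁ := by
    refine step_induction (l := l₀) (r := s₁) hδ0 hl₀ ?_ (le_max_left _ _) le_rfl
    intro s s' h1 h2 h3 h4 h5
    have hw : WellSeparated κ e s (s' + δ) :=
      wellSeparated_of_le hκ hδ2 hle (by linarith) (by linarith) (by linarith)
    have hw' : WellSeparated κ e s' (s' + δ) := hw.mono hκ h2 (by linarith) le_rfl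
    have hm := hu.mem hw'
    rcases hm.1.eq_or_lt with h | h
    · exact ⟨s' + δ, by linarith, hw', h.symm⟩
    · exfalso
      have hR := hu.rightPreferred_apply hw' h
      have hws := hw.mono hκ le_rfl (h2.trans hm.1) hm.2
      have e1 := hu.eq_right_of_rightPreferred hR hws
      have e2 := hu.eq_left_of_leftPreferred h5 hws
      linarith
  have e1 := hu.eq_right_of_rightPreferred hl hw₁
  have e2 := hu.eq_left_of_leftPreferred key hw₁
  linarith

/-- If no location is preferred by both agents, then being preferred by the right agent extends
to the right. -/
lemma rightPreferred_of_le (hu : LocalGame κ e u)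
    (hn : ∀ s, ¬ (RightPreferred κ e u s ∧ LeftPreferred κ e u s)) {l s : ℝ}
    (hl : RightPreferred κ e u l) (hls : l ≤ s) (hs : s < e) : RightPreferred κ e u s := by
  have hκ := hu.nonneg
  refine step_induction (l := l) (r := s) (δ := (e - s) / (2 * κ + 1))
    (div_pos (by linarith) (by linarith)) hl ?_ hls le_rfl
  intro t t' h1 h2 h3 h4 h5
  rcases h2.eq_or_lt with rfl | h2
  · exact h5
  have hw : WellSeparated κ e t t' := by
    refine wellSeparated_of_le hκ (δ := (e - s) / (2 * κ + 1)) (b := s) ?_ hs h2.le h3 ?_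
    · rw [mul_div_cancel₀ _ (by linarith)]
    · have : 0 < (e - s) / (2 * κ + 1) := div_pos (by linarith) (by linarith)
      linarith
  -- A facility at `t` would make `t` preferred by both agents, and one strictly inside would itself
  -- be preferred by both; only `t'` remains.
  have hm := hu.mem hw
  rcases hm.1.eq_or_lt with h | h
  · exact absurd ⟨h5, t', h2, hw, h.symm⟩ (hn t)
  rcases hm.2.eq_or_lt with h' | h'
  · exact ⟨t, h2, hw, h'⟩
  · exact absurd ⟨hu.rightPreferred_apply hw h, hu.leftPreferred_apply hw h'⟩ (hn _)

/-- A location preferred by both agents attracts the facility. -/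
lemma eq_of_preferred (hu : LocalGame κ e u) {a b l : ℝ} (hR : RightPreferred κ e u l)
    (hL : LeftPreferred κ e u l) (hal : a ≤ l) (hlb : l ≤ b) (hw : WellSeparated κ e a b) :
    u a b = l := by
  have hm := hu.mem hw
  refine le_antisymm ?_ ?_
  · by_contra! h
    exact absurd (hu.le_of_preferred (hu.rightPreferred_apply hw (hal.trans_lt h)) hL) (not_le.2 h)
  · by_contra! h
    exact absurd (hu.le_of_preferred hR (hu.leftPreferred_apply hw (h.trans_le hlb))) (not_le.2 h)

end LocalGame

/-! ### Three agents: the middle or the extremes -/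

/-- A strategyproof mechanism for three agents whose costs are at most a constant multiple of the
distance of any two of them. -/
structure IsNiceThree (ρ : ℝ) (G : ℝ → ℝ → ℝ → ℝ × ℝ) : Prop where
  nonneg : 0 ≤ ρ
  ordered : ∀ a b c, (G a b c).1 ≤ (G a b c).2
  curve₁ : ∀ b c, IsTruthfulCurve fun a => G a b c
  curve₂ : ∀ a c, IsTruthfulCurve fun b => G a b c
  curve₃ : ∀ a b, IsTruthfulCurve fun c => G a b c
  approx₁₂ : ∀ {a b c z}, z = a ∨ z = b ∨ z = c → agentCost z (G a b c) ≤ ρ * |a - b|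
  approx₁₃ : ∀ {a b c z}, z = a ∨ z = b ∨ z = c → agentCost z (G a b c) ≤ ρ * |a - c|
  approx₂₃ : ∀ {a b c z}, z = a ∨ z = b ∨ z = c → agentCost z (G a b c) ≤ ρ * |b - c|

/-- The pair of facilities reflected at the origin. -/
def reflectPair (y : ℝ × ℝ) : ℝ × ℝ := (-y.2, -y.1)

lemma agentCost_reflectPair (a : ℝ) (y : ℝ × ℝ) :
    agentCost a (reflectPair y) = agentCost (-a) y := by
  have h1 : |a - -y.2| = |-a - y.2| := by rw [← abs_neg]; ring_nf
  have h2 : |a - -y.1| = |-a - y.1| := by rw [← abs_neg]; ring_nf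
  rw [agentCost, agentCost, reflectPair, h1, h2, min_comm]

lemma hasFacilityAt_reflectPair {a : ℝ} {y : ℝ × ℝ} :
    HasFacilityAt (reflectPair y) a ↔ HasFacilityAt y (-a) := by
  rw [← agentCost_eq_zero_iff, ← agentCost_eq_zero_iff, agentCost_reflectPair]

/-- The mechanism on the reflected line, with the roles of the outer agents exchanged. -/
def reflect (G : ℝ → ℝ → ℝ → ℝ × ℝ) : ℝ → ℝ → ℝ → ℝ × ℝ :=
  fun a b c => reflectPair (G (-c) (-b) (-a))

lemma reflect_reflect (G : ℝ → ℝ → ℝ → ℝ × ℝ) : reflect (reflect G) = G := by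
  funext a b c
  simp [reflect, reflectPair]

/-- The facility on the left, as a function of the locations of the first two agents. -/
def leftFacility (G : ℝ → ℝ → ℝ → ℝ × ℝ) (c : ℝ) : ℝ → ℝ → ℝ := fun a b => (G a b c).1

/-- The second agent obtains a facility whenever she is in the middle of the two others, in the
order `1 < 2 < 3`. -/
def MiddleServed (G : ℝ → ℝ → ℝ → ℝ × ℝ) : Prop :=
  ∀ a b c, a < b → b < c → HasFacilityAt (G a b c) b

lemma MiddleServed.reflect {G : ℝ → ℝ → ℝ → ℝ × ℝ} (h : MiddleServed G) :
    MiddleServed (reflect G) := fun _ _ _ hab hbc =>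
  hasFacilityAt_reflectPair.2 (h _ _ _ (neg_lt_neg hbc) (neg_lt_neg hab))

lemma abs_neg_sub_neg_comm (a b : ℝ) : |-a - -b| = |b - a| := by
  congr 1; ring

lemma IsTruthfulCurve.reflect {f : ℝ → ℝ × ℝ} (hf : IsTruthfulCurve f) :
    IsTruthfulCurve fun x => reflectPair (f (-x)) := fun x x' => by
  simpa only [agentCost_reflectPair] using hf (-x) (-x')

namespace IsNiceThree

variable {ρ : ℝ} {G : ℝ → ℝ → ℝ → ℝ × ℝ}

lemma swap₂₃ (hG : IsNiceThree ρ G) : IsNiceThree ρ fun a b c => G a c b where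
  nonneg := hG.nonneg
  ordered _ _ _ := hG.ordered _ _ _
  curve₁ _ _ := hG.curve₁ _ _
  curve₂ _ _ := hG.curve₃ _ _
  curve₃ _ _ := hG.curve₂ _ _
  approx₁₂ h := hG.approx₁₃ (by tauto)
  approx₁₃ h := hG.approx₁₂ (by tauto)
  approx₂₃ {a b c z} h := by rw [abs_sub_comm]; exact hG.approx₂₃ (by tauto)

lemma reflect (hG : IsNiceThree ρ G) : IsNiceThree ρ (reflect G) where
  nonneg := hG.nonneg
  ordered _ _ _ := neg_le_neg (hG.ordered _ _ _)
  curve₁ _ _ := (hG.curve₃ _ _).reflect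
  curve₂ _ _ := (hG.curve₂ _ _).reflect
  curve₃ _ _ := (hG.curve₁ _ _).reflect
  approx₁₂ {a b c z} h := by
    rw [← abs_neg_sub_neg_comm, FacilityLocation.reflect, agentCost_reflectPair]
    exact hG.approx₂₃ (by rcases h with rfl | rfl | rfl <;> simp)
  approx₁₃ {a b c z} h := by
    rw [← abs_neg_sub_neg_comm, FacilityLocation.reflect, agentCost_reflectPair]
    exact hG.approx₁₃ (by rcases h with rfl | rfl | rfl <;> simp)
  approx₂₃ {a b c z} h := by
    rw [← abs_neg_sub_neg_comm, FacilityLocation.reflect, agentCost_reflectPair]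
    exact hG.approx₁₂ (by rcases h with rfl | rfl | rfl <;> simp)

lemma unanimous₁₂ (hG : IsNiceThree ρ G) {a c z : ℝ} (hz : z = a ∨ z = c) :
    HasFacilityAt (G a a c) z :=
  hasFacilityAt_of_agentCost_le_zero
    (by simpa using hG.approx₁₂ (a := a) (b := a) (c := c) (z := z) (by tauto))

lemma unanimous₂₃ (hG : IsNiceThree ρ G) {a c z : ℝ} (hz : z = a ∨ z = c) :
    HasFacilityAt (G a c c) z :=
  hasFacilityAt_of_agentCost_le_zero
    (by simpa using hG.approx₂₃ (a := a) (b := c) (c := c) (z := z) (by tauto))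

/-- If the first two agents are well separated from the third one, then exactly one facility is
near them, and it is between them. -/
lemma bounds (hG : IsNiceThree ρ G) {a b c : ℝ} (hw : WellSeparated (ρ + 1) c a b) :
    a ≤ (G a b c).1 ∧ (G a b c).1 ≤ b ∧ b + (b - a) < (G a b c).2 := by
  obtain ⟨hab, hbc, hsep⟩ := hw
  have ho := hG.ordered a b c
  have hc := hG.approx₁₂ (a := a) (b := b) (c := c) (z := c) (by tauto)
  rw [abs_sub_comm, abs_of_nonneg (sub_nonneg.2 hab), agentCost_le_iff] at hc
  have h2 : b + (b - a) < (G a b c).2 := by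
    rcases hc with h | h <;> rw [abs_le] at h <;> linarith
  -- Either agent of the pair could join the other and be served there, so her cost is at most `b -
  -- a`; the right facility is too far away for that.
  have ha : agentCost a (G a b c) ≤ b - a := by
    have := (hG.curve₁ b c).cost_le (hG.unanimous₁₂ (a := b) (c := c) (Or.inl rfl)) a
    rwa [abs_sub_comm, abs_of_nonneg (sub_nonneg.2 hab)] at this
  have hb : agentCost b (G a b c) ≤ b - a := by
    have := (hG.curve₂ a c).cost_le (hG.unanimous₁₂ (a := a) (c := c) (Or.inl rfl)) b
    rwa [abs_of_nonneg (sub_nonneg.2 hab)] at this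
  rw [agentCost_le_iff, abs_le, abs_le] at ha hb
  refine ⟨?_, ?_, h2⟩
  · rcases hb with h | h <;> linarith
  · rcases ha with h | h <;> linarith

lemma bounds_right (hG : IsNiceThree ρ G) {a b c : ℝ}
    (hw : WellSeparated (ρ + 1) (-a) (-c) (-b)) :
    (G a b c).1 < b - (c - b) ∧ b ≤ (G a b c).2 ∧ (G a b c).2 ≤ c := by
  have h := hG.reflect.bounds hw
  simp only [FacilityLocation.reflect, reflectPair, neg_neg] at h
  exact ⟨by linarith, by linarith, by linarith⟩

lemma localGame (hG : IsNiceThree ρ G) (c : ℝ) : LocalGame (ρ + 1) c (leftFacility G c) where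
  nonneg := by linarith [hG.nonneg]
  mem hw := ⟨(hG.bounds hw).1, (hG.bounds hw).2.1⟩
  sp_left {x x' y} hw hw' := by
    have h1 := hG.bounds hw
    rw [abs_sub_comm]
    refine le_trans ?_ ((hG.curve₁ y c).cost_le (x' := x') (Or.inl rfl) x)
    refine le_agentCost_iff.2 ⟨?_, ?_⟩
    · rw [abs_sub_comm]; exact le_abs_self _
    · rw [abs_sub_comm]
      exact le_trans (by simp only [leftFacility]; linarith [hw.1]) (le_abs_self _)
  sp_right {x y y'} hw hw' := by
    have h1 := hG.bounds hw
    refine le_trans ?_ ((hG.curve₂ x c).cost_le (x' := y') (Or.inl rfl) y)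
    refine le_agentCost_iff.2 ⟨le_abs_self _, ?_⟩
    rw [abs_sub_comm]
    exact le_trans (by simp only [leftFacility]; linarith [hw.1]) (le_abs_self _)

lemma eq_leftFacility (hG : IsNiceThree ρ G) {a b c z : ℝ} (hw : WellSeparated (ρ + 1) c a b)
    (hz : HasFacilityAt (G a b c) z) (hzb : z ≤ b) : leftFacility G c a b = z := by
  have h := hG.bounds hw
  rcases hz with rfl | rfl
  · rfl
  · linarith [hw.1]

lemma eq_rightFacility (hG : IsNiceThree ρ G) {a b c z : ℝ}
    (hw : WellSeparated (ρ + 1) (-a) (-c) (-b)) (hz : HasFacilityAt (G a b c) z) (hzb : b ≤ z) :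
    (G a b c).2 = z := by
  have h := hG.bounds_right hw
  rcases hz with rfl | rfl
  · linarith [hw.1]
  · rfl

/-- Provides the right anchor for `exists_hole` when agent 3 is the rightmost one, where unanimity
gives only the left anchor. -/
lemma exists_facility_right (hG : IsNiceThree ρ G) (a b m : ℝ) :
    ∃ r, m ≤ r ∧ HasFacilityAt (G a b r) r := by
  obtain ⟨z, hz, hzx⟩ := exists_hasFacilityAt_abs_le
    (hG.approx₁₂ (a := a) (b := b) (c := m + ρ * |a - b|) (z := m + ρ * |a - b|) (by tauto))
  rw [abs_le] at hzx
  exact ⟨z, by linarith, (hG.curve₃ a b).hasFacilityAt_self hz⟩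

/-- If the second agent is preferred in a well-separated instance, then she obtains a facility
wherever the first agent is located on her left. -/
lemma hasFacilityAt_of_rightPreferred (hG : IsNiceThree ρ G) {a l c : ℝ}
    (hl : RightPreferred (ρ + 1) c (leftFacility G c) l) (hal : a < l) :
    HasFacilityAt (G a l c) l := by
  have hρ := hG.nonneg
  -- Otherwise `l` lies in a hole of agent 2. Just right of its left end `l'` she is served at `l'`;
  -- agent 1 moving there makes `l'` left-preferred, although `l' < l`.
  by_contra hn
  have hlc : l < c := by obtain ⟨_, _, hw, _⟩ := hl; exact hw.2.1
  obtain ⟨l', r', h1, h2, h3, h4, -, h6, -⟩ := (hG.curve₂ a c).exists_hole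
    (hG.unanimous₁₂ (Or.inl rfl)) (hG.unanimous₂₃ (Or.inr rfl)) hal.le hlc.le hn
  obtain ⟨ε, hε, hε'⟩ := exists_pos_mul_lt (show 0 < (r' - l') / 2 by linarith) (ρ + 2)
  have hε2 : 0 ≤ ρ * ε := by positivity
  have hw : WellSeparated (ρ + 1) c l' (l' + ε) := ⟨by linarith, by linarith, by linarith⟩
  have h7 := (hG.curve₁ _ _).hasFacilityAt_self (h6 (l' + ε) (by linarith) (by linarith))
  have h8 := hG.eq_leftFacility hw h7 (by linarith)
  exact absurd ((hG.localGame c).le_of_preferred hl ⟨l' + ε, by linarith, hw, h8⟩) (not_le.2 h2)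

/-- No location is preferred by both of two agents. -/
lemma not_preferred (hG : IsNiceThree ρ G) (c l : ℝ) :
    ¬ (RightPreferred (ρ + 1) c (leftFacility G c) l ∧
      LeftPreferred (ρ + 1) c (leftFacility G c) l) := by
  rintro ⟨hR, hL⟩
  have hρ := hG.nonneg
  have hG' := hG.swap₂₃
  have hlc : l < c := by obtain ⟨_, _, hw, _⟩ := hR; exact hw.2.1
  obtain ⟨ε, hε, hε'⟩ := exists_pos_mul_lt (show 0 < c - l by linarith) ((ρ + 2) * 2)
  obtain ⟨η, hη, hη'⟩ := exists_pos_mul_lt hε (ρ + 2)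
  have hρε : 0 ≤ ρ * ε := by positivity
  have hρη : 0 ≤ ρ * η := by positivity
  have hw : WellSeparated (ρ + 1) c (l - η) (l + ε) := by
    refine ⟨by linarith, by linarith, ?_⟩
    have : (ρ + 1) * (l + ε - (l - η)) ≤ (ρ + 1) * (2 * ε) :=
      mul_le_mul_of_nonneg_left (by linarith) (by linarith)
    linarith
  have h1 : leftFacility G c (l - η) (l + ε) = l :=
    (hG.localGame c).eq_of_preferred hR hL (by linarith) (by linarith) hw
  -- Agent 3 takes the facility at `l`. Agents 1 and 3 are now the close pair, seen from agent 2 at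
  -- `l + ε`, and `l` is right-preferred in their game; `η` is small compared to `ε` for this
  -- purpose.
  have h2 : HasFacilityAt (G (l - η) (l + ε) l) l :=
    (hG.curve₃ _ _).hasFacilityAt_self (x := c) (Or.inl h1.symm)
  have hw' : WellSeparated (ρ + 1) (l + ε) (l - η) l := ⟨by linarith, by linarith, by linarith⟩
  have hR' : RightPreferred (ρ + 1) (l + ε) (leftFacility (fun a b c => G a c b) (l + ε)) l :=
    ⟨l - η, by linarith, hw', hG'.eq_leftFacility hw' h2 le_rfl⟩
  -- So far left that agents 2 and 3 become the well-separated pair.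
  set a := l - (ρ + 1) * (c - l) - 1 with ha
  have hal : a < l := by
    have : 0 ≤ (ρ + 1) * (c - l) := mul_nonneg (by linarith) (by linarith)
    linarith
  have h3 : HasFacilityAt (G a l c) l := hG.hasFacilityAt_of_rightPreferred hR hal
  have h4 : HasFacilityAt (G a (l + ε) l) l := hG'.hasFacilityAt_of_rightPreferred hR' hal
  have hwa : WellSeparated (ρ + 1) (-a) (-c) (-l) := ⟨by linarith, by linarith, by linarith⟩
  have hwa' : WellSeparated (ρ + 1) (-a) (-(l + ε)) (-l) :=
    hwa.mono (by linarith) (by linarith) (by linarith) le_rfl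
  have h5 := hG.eq_rightFacility hwa h3 le_rfl
  have h6 := hG'.eq_rightFacility hwa' h4 le_rfl
  have h7 : ¬ HasFacilityAt (G a l c) c := by
    have := (hG.bounds_right hwa).1
    rintro (h | h) <;> linarith
  -- Agent 3 is not served at `c`, and agent 2 can take over the right end `r` of her hole. In the
  -- reflected game of agents 3 and 2, `-l` is right-preferred and `-r` left-preferred, in the wrong
  -- order.
  obtain ⟨r₀, hr₀, hr₀'⟩ := hG.exists_facility_right a l c
  obtain ⟨l₁, r, g1, g2, g3, g4, -, -, g7⟩ := (hG.curve₃ a l).exists_hole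
    (hG.unanimous₂₃ (Or.inr rfl)) hr₀' hlc.le hr₀ h7
  obtain ⟨τ, hτ, hτ'⟩ := exists_pos_mul_lt (show 0 < (r - l₁) / 2 by linarith) (ρ + 2)
  have hρτ : 0 ≤ ρ * τ := by positivity
  have h8 : HasFacilityAt (G a r (r - τ)) r :=
    (hG.curve₂ _ _).hasFacilityAt_self (g7 (r - τ) (by linarith) (by linarith))
  have hwr : WellSeparated (ρ + 1) (-a) (-r) (-(r - τ)) :=
    ⟨by linarith, by linarith, by linarith⟩
  have h9 := hG'.eq_rightFacility hwr h8 (by linarith)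
  have := (hG'.reflect.localGame (-a)).le_of_preferred (l := -l) (l₀ := -r)
    ⟨-(l + ε), by linarith, hwa', ?_⟩ ⟨-(r - τ), by linarith, hwr, ?_⟩
  · linarith
  · simpa [leftFacility, FacilityLocation.reflect, reflectPair] using h6
  · simpa [leftFacility, FacilityLocation.reflect, reflectPair] using h9

/-- The left end of a hole of the middle agent, unless it is the location of the first agent, is
preferred by both of the first two agents. -/
lemma preferred_of_hole (hG : IsNiceThree ρ G) {a l r c : ℝ} (hal : a < l) (hlr : l < r)
    (hrc : r ≤ c) (h : ∀ x, l < x → x < (l + r) / 2 → HasFacilityAt (G a x c) l) :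
    RightPreferred (ρ + 1) c (leftFacility G c) l ∧
      LeftPreferred (ρ + 1) c (leftFacility G c) l := by
  have hρ := hG.nonneg
  obtain ⟨ε, hε, hε'⟩ := exists_pos_mul_lt
    (show 0 < min ((r - l) / 2) (l - a) from lt_min (by linarith) (by linarith)) (2 * ρ + 3)
  rw [lt_min_iff] at hε'
  have hρε : 0 ≤ ρ * ε := by positivity
  have hl := h (l + ε) (by linarith) (by linarith)
  have ho := hG.ordered a (l + ε) c
  -- Were `l` the right facility, agent 3 would profit from the report `l + ε + ε`, which brings a
  -- facility to `l + ε` or beyond.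
  have h1 : l = (G a (l + ε) c).1 := by
    rcases hl with h | h
    · exact h
    · exfalso
      have hb := hG.bounds_right (a := a) (b := l + ε) (c := l + ε + ε)
        ⟨by linarith, by linarith, by linarith⟩
      have h2 := (hG.curve₃ a (l + ε)).cost_le (x' := l + ε + ε) (Or.inr rfl) c
      have h3 : c - l ≤ agentCost c (G a (l + ε) c) :=
        le_agentCost_iff.2 ⟨le_trans (by linarith) (le_abs_self _),
          le_trans (by linarith) (le_abs_self _)⟩
      rw [abs_of_nonneg (by linarith)] at h2
      linarith
  have hw : WellSeparated (ρ + 1) c (l - ε) (l + ε) :=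
    ⟨by linarith, by linarith, by linarith⟩
  have hb := hG.bounds hw
  -- Truthfulness of agent 1 at `l - ε` and at `a` keeps the facility at `l`, now strictly between
  -- the pair and therefore preferred by both.
  have hu : leftFacility G c (l - ε) (l + ε) = l := by
    refine le_antisymm ?_ ?_
    · have h2 := (hG.curve₁ (l + ε) c).cost_le (x' := a) (z := l) (Or.inl h1) (l - ε)
      have h3 : leftFacility G c (l - ε) (l + ε) - (l - ε)
          ≤ agentCost (l - ε) (G (l - ε) (l + ε) c) := by
        rw [le_agentCost_iff, abs_sub_comm, abs_sub_comm _ (G (l - ε) (l + ε) c).2]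
        exact ⟨le_abs_self _, le_trans (by simp only [leftFacility]; linarith) (le_abs_self _)⟩
      have h4 : |l - ε - l| = ε := by rw [abs_sub_comm, abs_of_nonneg] <;> linarith
      linarith
    · have h2 := (hG.curve₁ (l + ε) c).cost_le (x' := l - ε) (Or.inl rfl) a
      have h3 : l - a ≤ agentCost a (G a (l + ε) c) := by
        rw [le_agentCost_iff, abs_sub_comm, abs_sub_comm _ (G a (l + ε) c).2]
        exact ⟨le_trans (by linarith) (le_abs_self _), le_trans (by linarith) (le_abs_self _)⟩
      rw [abs_sub_comm, abs_of_nonneg (by linarith)] at h2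
      simp only [leftFacility]
      linarith
  have hR := (hG.localGame c).rightPreferred_apply hw (by linarith)
  have hL := (hG.localGame c).leftPreferred_apply hw (by linarith)
  rw [hu] at hR hL
  exact ⟨hR, hL⟩

/-- For fixed locations of the outer agents, either every location in the middle is served or
none. -/
lemma hasFacilityAt_middle (hG : IsNiceThree ρ G) {a b b' c : ℝ} (hab : a < b) (hbc : b < c)
    (h : HasFacilityAt (G a b c) b) (hab' : a < b') (hbc' : b' < c) :
    HasFacilityAt (G a b' c) b' := by
  by_contra hn
  obtain ⟨l, r, h1, h2, h3, h4, h5, h6, h7⟩ := (hG.curve₂ a c).exists_hole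
    (hG.unanimous₁₂ (Or.inl rfl)) (hG.unanimous₂₃ (Or.inr rfl)) hab'.le hbc'.le hn
  -- A hole ending strictly between `a` and `c` contradicts `not_preferred`, after reflection if it
  -- is the right end; a hole filling the gap contains `b`.
  rcases h1.eq_or_lt with rfl | h1
  · rcases h4.eq_or_lt with rfl | h4
    · exact h5 b hab hbc h
    · refine hG.reflect.not_preferred (-a) (-r) (hG.reflect.preferred_of_hole (a := -c) (r := -a)
        (by linarith) (by linarith) (by linarith) fun x hx hx' => ?_)
      rw [FacilityLocation.reflect, hasFacilityAt_reflectPair]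
      simpa using h7 (-x) (by linarith) (by linarith)
  · exact hG.not_preferred c l (hG.preferred_of_hole h1 (by linarith) h4 h6)

/-- Agent 2 is first moved close to agent 1, where being served means being preferred in the local
game. This preference spreads to the right and secures a facility wherever agent 1 stands on the
left. -/
lemma hasFacilityAt_left (hG : IsNiceThree ρ G) {a b c a' b' : ℝ} (hab : a < b) (hbc : b < c)
    (h : HasFacilityAt (G a b c) b) (hab' : a' < b') (hbc' : b' < c) :
    HasFacilityAt (G a' b' c) b' := by
  have hρ := hG.nonneg
  obtain ⟨ε, hε, hε'⟩ := exists_pos_mul_lt (show 0 < c - a by linarith) (ρ + 2)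
  have hρε : 0 ≤ ρ * ε := by positivity
  have hw : WellSeparated (ρ + 1) c a (a + ε) := ⟨by linarith, by linarith, by linarith⟩
  have h1 : HasFacilityAt (G a (a + ε) c) (a + ε) :=
    hG.hasFacilityAt_middle hab hbc h (by linarith) (by linarith)
  have hR : RightPreferred (ρ + 1) c (leftFacility G c) (a + ε) :=
    ⟨a, by linarith, hw, hG.eq_leftFacility hw h1 le_rfl⟩
  rcases le_or_gt (a + ε) b' with hb | hb
  · exact hG.hasFacilityAt_of_rightPreferred
      ((hG.localGame c).rightPreferred_of_le (hG.not_preferred c) hR hb hbc') hab'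
  · exact hG.hasFacilityAt_middle (hab'.trans hb) (by linarith)
      (hG.hasFacilityAt_of_rightPreferred hR (hab'.trans hb)) hab' hbc'

lemma hasFacilityAt_right (hG : IsNiceThree ρ G) {a b c b' c' : ℝ} (hab : a < b) (hbc : b < c)
    (h : HasFacilityAt (G a b c) b) (hab' : a < b') (hbc' : b' < c') :
    HasFacilityAt (G a b' c') b' := by
  have h1 := hG.reflect.hasFacilityAt_left (a := -c) (b := -b) (c := -a) (a' := -c') (b' := -b')
    (by linarith) (by linarith)
    (by simpa [FacilityLocation.reflect, hasFacilityAt_reflectPair] using h)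
    (by linarith) (by linarith)
  simpa [FacilityLocation.reflect, hasFacilityAt_reflectPair] using h1

lemma middleServed_of_hasFacilityAt (hG : IsNiceThree ρ G) {a b c : ℝ} (hab : a < b)
    (hbc : b < c) (h : HasFacilityAt (G a b c) b) : MiddleServed G := by
  intro a' b' c' hab' hbc'
  have h1 := min_le_left a a'
  have h2 := min_le_right a a'
  exact hG.hasFacilityAt_left (by linarith) (by linarith)
    (hG.hasFacilityAt_right (a := min a a') (b := b) (c := c) (b' := b') (c' := c') (by linarith)
      hbc (hG.hasFacilityAt_left hab hbc h (by linarith) hbc) (by linarith) hbc') hab' hbc'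

/-- In a hole around `c`, agent 3 would be served at its left end `l ≥ b` from slightly further
right; agent 2 could take that facility and be served in the middle. -/
lemma hasFacilityAt_third (hG : IsNiceThree ρ G) (hn : ¬ MiddleServed G) {a b c : ℝ}
    (hab : a < b) (hbc : b < c) : HasFacilityAt (G a b c) c := by
  by_contra hc
  obtain ⟨r₀, hr₀, hr₀'⟩ := hG.exists_facility_right a b c
  obtain ⟨l, r, g1, g2, g3, g4, -, g6, -⟩ := (hG.curve₃ a b).exists_hole
    (hG.unanimous₂₃ (Or.inr rfl)) hr₀' hbc.le hr₀ hc
  have h1 := g6 ((l + (l + r) / 2) / 2) (by linarith) (by linarith)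
  exact hn (hG.middleServed_of_hasFacilityAt (by linarith) (by linarith)
    ((hG.curve₂ _ _).hasFacilityAt_self h1))

/-- Either the middle agent always obtains a facility, or the facilities are always at the two
extremes. -/
theorem eq_extremes (hG : IsNiceThree ρ G) (hn : ¬ MiddleServed G) {a b c : ℝ}
    (hab : a < b) (hbc : b < c) : G a b c = (a, c) := by
  have h1 := hG.hasFacilityAt_third hn hab hbc
  have h2 : HasFacilityAt (G a b c) a := by
    have h := hG.reflect.hasFacilityAt_third
      (fun h => hn (reflect_reflect G ▸ h.reflect))
      (neg_lt_neg hbc) (neg_lt_neg hab)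
    simpa [FacilityLocation.reflect, hasFacilityAt_reflectPair] using h
  have ho := hG.ordered a b c
  rcases h1 with h1 | h1 <;> rcases h2 with h2 | h2
  · linarith
  · linarith
  · exact Prod.ext h2.symm h1.symm
  · linarith

/-- The middle agents cannot be served both in the order `1 < 2 < 3` and in `1 < 3 < 2`. -/
lemma not_middleServed_swap₂₃ (hG : IsNiceThree ρ G) (h : MiddleServed G) :
    ¬ MiddleServed fun a b c => G a c b := by
  intro h'
  have hρ := hG.nonneg
  obtain ⟨ε, hε, hε'⟩ := exists_pos_mul_lt one_pos (ρ + 2)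
  have hρε : 0 ≤ ρ * ε := by positivity
  have hw : WellSeparated (ρ + 1) (-0) (-(1 + ε)) (-1) :=
    ⟨by linarith, by linarith, by linarith⟩
  have h1 := hG.bounds_right hw
  have h2 := hG.eq_rightFacility hw (h 0 1 (1 + ε) (by linarith) (by linarith)) le_rfl
  -- Agent 3 is in a hole, whose right end `r` agent 2 can take over. With agent 3 at `r - τ`, the
  -- other order demands that the same facility be there.
  have h3 : ¬ HasFacilityAt (G 0 1 (1 + ε)) (1 + ε) := by rintro (h | h) <;> linarith
  obtain ⟨r₀, hr₀, hr₀'⟩ := hG.exists_facility_right 0 1 (1 + ε)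
  obtain ⟨l, r, g1, g2, g3, g4, -, -, g7⟩ := (hG.curve₃ 0 1).exists_hole
    (hG.unanimous₂₃ (Or.inr rfl)) hr₀' (by linarith) hr₀ h3
  obtain ⟨τ, hτ, hτ'⟩ := exists_pos_mul_lt (show 0 < (r - l) / 2 by linarith) (ρ + 2)
  have hρτ : 0 ≤ ρ * τ := by positivity
  have h8 : HasFacilityAt (G 0 r (r - τ)) r :=
    (hG.curve₂ _ _).hasFacilityAt_self (g7 (r - τ) (by linarith) (by linarith))
  have hwr : WellSeparated (ρ + 1) (-0) (-r) (-(r - τ)) :=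
    ⟨by linarith, by linarith, by linarith⟩
  have h9 := hG.swap₂₃.eq_rightFacility hwr h8 (by linarith)
  have h10 := hG.swap₂₃.eq_rightFacility hwr (h' 0 (r - τ) r (by linarith) (by linarith)) le_rfl
  linarith

/-- The middle agents cannot be served both in the order `1 < 2 < 3` and in `2 < 1 < 3`. -/
lemma not_middleServed_swap₁₂ (hG : IsNiceThree ρ G) (h : MiddleServed G) :
    ¬ MiddleServed fun a b c => G b a c :=
  fun h' => hG.reflect.not_middleServed_swap₂₃ h.reflect h'.reflect

end IsNiceThree

/-! ### Four agents: splitting a served pair -/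

/-- A strategyproof mechanism for four agents, where the outer agents obtain a nearby facility if
the three others are close to each other. -/
structure IsNiceFour (ρ : ℝ) (H : ℝ → ℝ → ℝ → ℝ → ℝ × ℝ) : Prop where
  nonneg : 0 ≤ ρ
  ordered : ∀ a b k c, (H a b k c).1 ≤ (H a b k c).2
  curve₁ : ∀ b k c, IsTruthfulCurve fun a => H a b k c
  curve₂ : ∀ a k c, IsTruthfulCurve fun b => H a b k c
  curve₃ : ∀ a b c, IsTruthfulCurve fun k => H a b k c
  curve₄ : ∀ a b k, IsTruthfulCurve fun c => H a b k c
  approx_left : ∀ {a b k c}, a ≤ b → b ≤ k → k ≤ c → agentCost a (H a b k c) ≤ ρ * (c - b)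
  approx_right : ∀ {a b k c}, a ≤ b → b ≤ k → k ≤ c → agentCost c (H a b k c) ≤ ρ * (k - a)

namespace IsNiceFour

variable {ρ : ℝ} {H : ℝ → ℝ → ℝ → ℝ → ℝ × ℝ}

lemma left_le (hH : IsNiceFour ρ H)
    (hE : ∀ a b c, a < b → b < c → H a b c c = (a, c))
    (hE' : ∀ a b c, a < b → b < c → H a a b c = (a, c)) {a b k c : ℝ} (hab : a < b)
    (hbk : b < k) (hkc : k ≤ c) : (H a b k c).1 ≤ b := by
  rcases hkc.eq_or_lt with rfl | hkc
  · rw [hE a b k hab hbk]; exact hab.le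
  · have h := (hH.curve₁ b k c).cost_le (x' := b) (z := b)
      (by rw [hE' b k c hbk hkc]; exact Or.inl rfl) a
    have ho := hH.ordered a b k c
    rw [abs_sub_comm, abs_of_pos (sub_pos.2 hab), agentCost_le_iff, abs_le, abs_le] at h
    rcases h with h | h <;> linarith

lemma right_mem (hH : IsNiceFour ρ H)
    (hE : ∀ a b c, a < b → b < c → H a b c c = (a, c))
    (hE' : ∀ a b c, a < b → b < c → H a a b c = (a, c)) {a b k c : ℝ} (hab : a < b)
    (hbk : b < k) (hkc : k ≤ c) (hs : c - k < k - b) :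
    k ≤ (H a b k c).2 ∧ (H a b k c).2 ≤ c := by
  have h0 := hH.left_le hE hE' hab hbk hkc
  have h1 := (hH.curve₃ a b c).cost_le (x' := c) (z := c)
    (by rw [hE a b c hab (hbk.trans_le hkc)]; exact Or.inr rfl) k
  have h2 := (hH.curve₄ a b k).cost_le (x' := k) (z := k)
    (by rw [hE a b k hab hbk]; exact Or.inr rfl) c
  rw [abs_sub_comm, abs_of_nonneg (sub_nonneg.2 hkc), agentCost_le_iff, abs_le, abs_le] at h1
  rw [abs_of_nonneg (sub_nonneg.2 hkc), agentCost_le_iff, abs_le, abs_le] at h2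
  constructor
  · rcases h2 with h | h <;> linarith
  · rcases h1 with h | h <;> linarith

/-- The left facility stays at or left of `b`, so the last two agents compete for the right one
alone while they are closer to each other than to `b`. Reflection turns `b` into the separating
point on the right. -/
lemma localGame (hH : IsNiceFour ρ H)
    (hE : ∀ a b c, a < b → b < c → H a b c c = (a, c))
    (hE' : ∀ a b c, a < b → b < c → H a a b c = (a, c)) {a b : ℝ} (hab : a < b) :
    LocalGame 1 (-b) fun x y => -(H a b (-y) (-x)).2 where
  nonneg := zero_le_one
  mem {x y} hw := by
    have h := hH.right_mem hE hE' hab (k := -y) (c := -x) (by linarith [hw.2.1])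
      (by linarith [hw.1]) (by linarith [hw.2.2])
    constructor <;> linarith
  sp_left {x x' y} hw hw' := by
    obtain ⟨h1, h2, h3⟩ := hw
    have h4 := hH.left_le hE hE' hab (k := -y) (c := -x) (by linarith) (by linarith)
    have h5 := hH.right_mem hE hE' hab (k := -y) (c := -x) (by linarith) (by linarith)
      (by linarith)
    have h6 := (hH.curve₄ a b (-y)).cost_le (x' := -x') (Or.inr rfl) (-x)
    have h7 : -(H a b (-y) (-x)).2 - x ≤ agentCost (-x) (H a b (-y) (-x)) :=
      le_agentCost_iff.2 ⟨le_trans (by linarith) (le_abs_self _),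
        le_trans (by linarith) (le_abs_self _)⟩
    refine (h7.trans h6).trans (le_of_eq ?_)
    congr 1; ring
  sp_right {x y y'} hw hw' := by
    obtain ⟨h1, h2, h3⟩ := hw
    have h4 := hH.left_le hE hE' hab (k := -y) (c := -x) (by linarith) (by linarith)
    have h5 := hH.right_mem hE hE' hab (k := -y) (c := -x) (by linarith) (by linarith)
      (by linarith)
    have h6 := (hH.curve₃ a b (-x)).cost_le (x' := -y') (Or.inr rfl) (-y)
    have h7 : y - -(H a b (-y) (-x)).2 ≤ agentCost (-y) (H a b (-y) (-x)) := by
      rw [le_agentCost_iff, abs_sub_comm _ (H a b (-y) (-x)).2]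
      exact ⟨le_trans (by linarith) (le_abs_self _), le_trans (by linarith) (le_abs_self _)⟩
    refine (h7.trans h6).trans (le_of_eq ?_)
    rw [← abs_neg]
    congr 1; ring

/-- If the second and the third agent together are served in the middle, then one of them is, even
if the other one joins the outer agent on her side. -/
theorem not_middleServed (hH : IsNiceFour ρ H)
    (hE : ∀ a b c, a < b → b < c → H a b c c = (a, c))
    (hE' : ∀ a b c, a < b → b < c → H a a b c = (a, c)) :
    ¬ MiddleServed fun a b c => H a b b c := by
  intro hD
  have hρ := hH.nonneg
  -- A cost of at most `3 * ρ` for agent 1 forces a facility left of `0`.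
  set a : ℝ := -(3 * ρ + 1) with ha
  have ha0 : a < 0 := by linarith
  have hgame := hH.localGame hE hE' ha0
  -- Otherwise agent 2 takes over the left end `l` of agent 3's hole, which becomes the right
  -- facility; but agent 4 at `3` would profit from joining agent 3 at `x > l`.
  have h1 : HasFacilityAt (H a 0 2 3) 2 := by
    by_contra hn
    obtain ⟨l, r, g1, g2, g3, g4, -, g6, -⟩ := (hH.curve₃ a 0 3).exists_hole
      (hD a 0 3 ha0 (by norm_num)) (by rw [hE a 0 3 ha0 (by norm_num)]; exact Or.inr rfl)
      zero_le_two (by norm_num) hn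
    obtain ⟨x, hx, hx'⟩ := exists_between (show l < (l + r) / 2 by linarith)
    have h2 : HasFacilityAt (H a l x 3) l := (hH.curve₂ _ _ _).hasFacilityAt_self (g6 x hx hx')
    have ho := hH.ordered a l x 3
    have h3 := hH.left_le hE hE' (a := a) (b := l) (k := x) (c := 3) (by linarith) hx (by linarith)
    have h4 := hH.approx_left (a := a) (b := l) (k := x) (c := 3) (by linarith) hx.le (by linarith)
    have h5 : ρ * (3 - l) ≤ ρ * 3 := mul_le_mul_of_nonneg_left (by linarith) hρ
    have h6 := (hH.curve₄ a l x).cost_le (x' := x) (z := x)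
      (by rw [hE a l x (by linarith) hx]; exact Or.inr rfl) 3
    rw [abs_of_pos (by linarith)] at h6
    rw [agentCost_le_iff, abs_le, abs_le] at h4 h6
    rcases h2 with h2 | h2
    · rcases h4 with h4 | h4 <;> linarith
    · rcases h6 with h6 | h6 <;> linarith
  have h2 : RightPreferred 1 (-0) (fun x y => -(H a 0 (-y) (-x)).2) (-2) := by
    refine ⟨-3, by norm_num, ⟨by norm_num, by norm_num, by norm_num⟩, ?_⟩
    have h3 := hH.left_le hE hE' ha0 (k := 2) (c := 3) (by norm_num) (by norm_num)
    simp only [neg_neg, neg_inj]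
    rcases h1 with h | h
    · linarith
    · exact h.symm
  -- Otherwise agent 4 takes over the right end `r > 2` of agent 3's hole, making `-r`
  -- left-preferred below `-2`. The pair is well separated since `l ≥ 0` and `x` is past the
  -- midpoint.
  have h3 : ∀ c, 2 < c → HasFacilityAt (H a 0 2 c) 2 := by
    intro c hc
    by_contra hn
    obtain ⟨l, r, g1, g2, g3, g4, -, -, g7⟩ := (hH.curve₃ a 0 c).exists_hole
      (hD a 0 c ha0 (by linarith)) (by rw [hE a 0 c ha0 (by linarith)]; exact Or.inr rfl)
      zero_le_two hc.le hn
    obtain ⟨x, hx, hx'⟩ := exists_between (show (l + r) / 2 < r by linarith)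
    have h4 : HasFacilityAt (H a 0 x r) r := (hH.curve₄ _ _ _).hasFacilityAt_self (g7 x hx hx')
    have h5 := hH.left_le hE hE' ha0 (k := x) (c := r) (by linarith) hx'.le
    refine absurd (hgame.le_of_preferred h2 (l₀ := -r)
      ⟨-x, by linarith, ⟨by linarith, by linarith, by linarith⟩, ?_⟩) (by linarith)
    simp only [neg_neg, neg_inj]
    rcases h4 with h | h
    · linarith
    · exact h.symm
  -- The approximation bound for agent 4 demands a facility at `3` or beyond, but one is at most `0`
  -- and the other is at `2`.
  set c := 3 + ρ * (2 - a) with hc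
  have hc2 : 2 < c := by
    have : 0 ≤ ρ * (2 - a) := mul_nonneg hρ (by linarith)
    linarith
  have h4 := hH.left_le hE hE' ha0 (k := 2) (c := c) two_pos hc2.le
  have h5 := hH.approx_right (a := a) (b := 0) (k := 2) (c := c) ha0.le zero_le_two hc2.le
  rw [agentCost_le_iff, abs_le, abs_le] at h5
  rcases h3 c hc2 with h | h <;> rcases h5 with h5 | h5 <;> linarith

end IsNiceFour

/-! ### From agents to coalitions -/

variable {n : ℕ} {F : Mechanism n} {ρ : ℝ}

/-- Agents at the same location do not profit from misreporting their locations together. -/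
lemma Strategyproof.agentCost_le_of_coalition (hF : Strategyproof F) (S : Finset (Fin n)) {t : ℝ}
    {x x' : Instance n} (hx : ∀ i ∈ S, x i = t) (hxx' : ∀ i ∉ S, x' i = x i) :
    agentCost t (F.outcome x) ≤ agentCost t (F.outcome x') := by
  induction S using Finset.induction_on generalizing x' with
  | empty =>
    have : x' = x := funext fun i => hxx' i (Finset.notMem_empty i)
    rw [this]
  | insert i S hi ih =>
    have h1 := ih (x' := Function.update x' i t) (fun j hj => hx j (Finset.mem_insert_of_mem hj))
      fun j hj => by
        by_cases hji : j = i
        · subst hji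
          rw [Function.update_self, hx j (Finset.mem_insert_self _ _)]
        · rw [Function.update_of_ne hji]
          exact hxx' j (by simp [hji, hj])
    have h2 := hF (Function.update x' i t) i (x' i)
    rw [Function.update_self, Function.update_idem, Function.update_eq_self] at h2
    exact h1.trans h2

/-- The agents of each coalition are at the same location, and one coalition moves. -/
lemma Strategyproof.isTruthfulCurve (hF : Strategyproof F) {m : ℕ} (col : Fin n → Fin m)
    (p : Fin m → ℝ) (k : Fin m) :
    IsTruthfulCurve fun t => F.outcome (Function.update p k t ∘ col) := by
  intro t t'
  refine hF.agentCost_le_of_coalition {i | col i = k} ?_ ?_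
  · intro i hi
    have : col i = k := by simpa using hi
    simp [this]
  · intro i hi
    have : col i ≠ k := by simpa using hi
    simp [this]

lemma Strategyproof.isTruthfulCurve_of_update (hF : Strategyproof F) {m : ℕ}
    {col : Fin n → Fin m} {q : ℝ → Fin m → ℝ} (p : Fin m → ℝ) (k : Fin m)
    (hq : ∀ t, q t = Function.update p k t) : IsTruthfulCurve fun t => F.outcome (q t ∘ col) := by
  simpa only [hq] using hF.isTruthfulCurve col p k

lemma HasApproxRatio.agentCost_le (hF : HasApproxRatio F ρ) {x : Instance n} {D : ℝ}
    (y : ℝ × ℝ) (hy : ∀ i, agentCost (x i) y ≤ D) (i : Fin n) :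
    agentCost (x i) (F.outcome x) ≤ ρ * n * D := by
  have h1 : agentCost (x i) (F.outcome x) ≤ socialCost x (F.outcome x) :=
    Finset.single_le_sum (f := fun i => agentCost (x i) (F.outcome x))
      (fun _ _ => agentCost_nonneg _ _) (Finset.mem_univ i)
  have h2 : optimalCost x ≤ socialCost x y :=
    ciInf_le ⟨0, by rintro _ ⟨z, rfl⟩; exact Finset.sum_nonneg fun _ _ => agentCost_nonneg _ _⟩ y
  have h3 : socialCost x y ≤ n * D := by
    refine (Finset.sum_le_card_nsmul Finset.univ _ D fun i _ => hy i).trans ?_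
    simp
  calc agentCost (x i) (F.outcome x) ≤ ρ * optimalCost x := h1.trans (hF.2 x)
    _ ≤ ρ * (n * D) := mul_le_mul_of_nonneg_left (h2.trans h3) (by linarith [hF.1])
    _ = ρ * n * D := by ring

/-- The mechanism for three agents that arises from moving three coalitions. -/
def tripleMechanism (F : Mechanism n) (col : Fin n → Fin 3) : ℝ → ℝ → ℝ → ℝ × ℝ :=
  fun a b c => F.outcome (![a, b, c] ∘ col)

/-- The mechanism for four agents that arises from moving four coalitions. -/
def quadrupleMechanism (F : Mechanism n) (col : Fin n → Fin 4) : ℝ → ℝ → ℝ → ℝ → ℝ × ℝ :=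
  fun a b k c => F.outcome (![a, b, k, c] ∘ col)

lemma HasApproxRatio.agentCost_coalition_le (hF : HasApproxRatio F ρ) {m : ℕ}
    {col : Fin n → Fin m} (hcol : Function.Surjective col) {p : Fin m → ℝ} {D : ℝ}
    (y : ℝ × ℝ) (hy : ∀ k, agentCost (p k) y ≤ D) (k : Fin m) :
    agentCost (p k) (F.outcome (p ∘ col)) ≤ ρ * n * D := by
  obtain ⟨i, rfl⟩ := hcol k
  exact hF.agentCost_le (x := p ∘ col) y (fun i => hy (col i)) i

lemma isNiceThree_tripleMechanism (hSP : Strategyproof F) (hF : HasApproxRatio F ρ)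
    {col : Fin n → Fin 3} (hcol : Function.Surjective col) :
    IsNiceThree (ρ * n) (tripleMechanism F col) where
  nonneg := mul_nonneg (by linarith [hF.1]) n.cast_nonneg
  ordered _ _ _ := F.ordered _
  curve₁ b c := hSP.isTruthfulCurve_of_update ![0, b, c] 0 fun t => by ext j; fin_cases j <;> rfl
  curve₂ a c := hSP.isTruthfulCurve_of_update ![a, 0, c] 1 fun t => by ext j; fin_cases j <;> rfl
  curve₃ a b := hSP.isTruthfulCurve_of_update ![a, b, 0] 2 fun t => by ext j; fin_cases j <;> rfl
  approx₁₂ {a b c z} hz := by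
    have h := hF.agentCost_coalition_le hcol (p := ![a, b, c]) (D := |a - b|) (a, c) (by
      intro k
      fin_cases k <;> simp [agentCost, abs_sub_comm])
    rcases hz with rfl | rfl | rfl
    exacts [h 0, h 1, h 2]
  approx₁₃ {a b c z} hz := by
    have h := hF.agentCost_coalition_le hcol (p := ![a, b, c]) (D := |a - c|) (a, b) (by
      intro k
      fin_cases k <;> simp [agentCost, abs_sub_comm])
    rcases hz with rfl | rfl | rfl
    exacts [h 0, h 1, h 2]
  approx₂₃ {a b c z} hz := by
    have h := hF.agentCost_coalition_le hcol (p := ![a, b, c]) (D := |b - c|) (a, c) (by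
      intro k
      fin_cases k <;> simp [agentCost, abs_sub_comm])
    rcases hz with rfl | rfl | rfl
    exacts [h 0, h 1, h 2]

lemma isTruthfulCurve_quadruple (hSP : Strategyproof F) (col : Fin n → Fin 4) (a b k c : ℝ) :
    IsTruthfulCurve (fun t => quadrupleMechanism F col t b k c) ∧
    IsTruthfulCurve (fun t => quadrupleMechanism F col a t k c) ∧
    IsTruthfulCurve (fun t => quadrupleMechanism F col a b t c) ∧
    IsTruthfulCurve (fun t => quadrupleMechanism F col a b k t) := by
  refine ⟨?_, ?_, ?_, ?_⟩
  · exact hSP.isTruthfulCurve_of_update ![0, b, k, c] 0 fun t => by ext j; fin_cases j <;> rfl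
  · exact hSP.isTruthfulCurve_of_update ![a, 0, k, c] 1 fun t => by ext j; fin_cases j <;> rfl
  · exact hSP.isTruthfulCurve_of_update ![a, b, 0, c] 2 fun t => by ext j; fin_cases j <;> rfl
  · exact hSP.isTruthfulCurve_of_update ![a, b, k, 0] 3 fun t => by ext j; fin_cases j <;> rfl

lemma isNiceFour_quadrupleMechanism (hSP : Strategyproof F) (hF : HasApproxRatio F ρ)
    {col : Fin n → Fin 4} (hcol : Function.Surjective col) :
    IsNiceFour (ρ * n) (quadrupleMechanism F col) where
  nonneg := mul_nonneg (by linarith [hF.1]) n.cast_nonneg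
  ordered _ _ _ _ := F.ordered _
  curve₁ b k c := (isTruthfulCurve_quadruple hSP col 0 b k c).1
  curve₂ a k c := (isTruthfulCurve_quadruple hSP col a 0 k c).2.1
  curve₃ a b c := (isTruthfulCurve_quadruple hSP col a b 0 c).2.2.1
  curve₄ a b k := (isTruthfulCurve_quadruple hSP col a b k 0).2.2.2
  approx_left {a b k c} h1 h2 h3 := by
    refine hF.agentCost_coalition_le hcol (p := ![a, b, k, c]) (D := c - b) (a, c) ?_ 0
    intro i
    fin_cases i
    · exact agentCost_le_iff.2 (Or.inl (by simp; linarith))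
    · exact agentCost_le_iff.2 (Or.inr (by simp [abs_le]; linarith))
    · exact agentCost_le_iff.2 (Or.inr (by simp [abs_le]; constructor <;> linarith))
    · exact agentCost_le_iff.2 (Or.inr (by simp; linarith))
  approx_right {a b k c} h1 h2 h3 := by
    refine hF.agentCost_coalition_le hcol (p := ![a, b, k, c]) (D := k - a) (a, c) ?_ 3
    intro i
    fin_cases i
    · exact agentCost_le_iff.2 (Or.inl (by simp; linarith))
    · exact agentCost_le_iff.2 (Or.inl (by simp [abs_le]; constructor <;> linarith))
    · exact agentCost_le_iff.2 (Or.inl (by simp [abs_le]; linarith))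
    · exact agentCost_le_iff.2 (Or.inr (by simp; linarith))

lemma tripleMechanism_comp {m : ℕ} (f : Fin m → Fin 3) (q : Fin n → Fin m) {p : Fin m → ℝ}
    {a b c : ℝ} (h : ![a, b, c] ∘ f = p) :
    tripleMechanism F (f ∘ q) a b c = F.outcome (p ∘ q) := by
  rw [tripleMechanism, ← Function.comp_assoc, h]

lemma tripleMechanism_merge_middle (q : Fin n → Fin 4) (a b c : ℝ) :
    tripleMechanism F (![0, 1, 1, 2] ∘ q) a b c = quadrupleMechanism F q a b b c :=
  tripleMechanism_comp _ _ (by ext j; fin_cases j <;> rfl)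

lemma tripleMechanism_merge_left (q : Fin n → Fin 4) (a b c : ℝ) :
    tripleMechanism F (![0, 0, 1, 2] ∘ q) a b c = quadrupleMechanism F q a a b c :=
  tripleMechanism_comp _ _ (by ext j; fin_cases j <;> rfl)

lemma tripleMechanism_merge_right (q : Fin n → Fin 4) (a b c : ℝ) :
    tripleMechanism F (![0, 1, 2, 2] ∘ q) a b c = quadrupleMechanism F q a b c c :=
  tripleMechanism_comp _ _ (by ext j; fin_cases j <;> rfl)

lemma tripleMechanism_swap₁₂ (col : Fin n → Fin 3) (a b c : ℝ) :
    tripleMechanism F (![1, 0, 2] ∘ col) a b c = tripleMechanism F col b a c :=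
  tripleMechanism_comp _ _ (by ext j; fin_cases j <;> rfl)

lemma tripleMechanism_swap₂₃ (col : Fin n → Fin 3) (a b c : ℝ) :
    tripleMechanism F (![0, 2, 1] ∘ col) a b c = tripleMechanism F col a c b :=
  tripleMechanism_comp _ _ (by ext j; fin_cases j <;> rfl)

/-! ### Served coalitions and the dictator -/

/-- The coalition with colour `1` is served whenever it is between the two other ones, with the
coalition `0` on its left and the coalition `2` on its right. -/
def CoalitionServed (F : Mechanism n) (col : Fin n → Fin 3) : Prop :=
  MiddleServed (tripleMechanism F col)

/-- The newcomers walk from the left end to the facility in the middle and keep it there. -/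
lemma CoalitionServed.absorb_left (hSP : Strategyproof F) {q : Fin n → Fin 4}
    (h : CoalitionServed F (![0, 0, 1, 2] ∘ q)) : CoalitionServed F (![0, 1, 1, 2] ∘ q) := by
  intro a b c hab hbc
  have := h a b c hab hbc
  rw [tripleMechanism_merge_left] at this
  rw [tripleMechanism_merge_middle]
  exact (isTruthfulCurve_quadruple hSP q a 0 b c).2.1.hasFacilityAt_self this

lemma CoalitionServed.absorb_right (hSP : Strategyproof F) {q : Fin n → Fin 4}
    (h : CoalitionServed F (![0, 1, 2, 2] ∘ q)) : CoalitionServed F (![0, 1, 1, 2] ∘ q) := by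
  intro a b c hab hbc
  have := h a b c hab hbc
  rw [tripleMechanism_merge_right] at this
  rw [tripleMechanism_merge_middle]
  exact (isTruthfulCurve_quadruple hSP q a b 0 c).2.2.1.hasFacilityAt_self this

lemma CoalitionServed.not_swap₁₂ (hSP : Strategyproof F) (hF : HasApproxRatio F ρ)
    {col : Fin n → Fin 3} (hcol : Function.Surjective col)
    (h : CoalitionServed F col) : ¬ CoalitionServed F (![1, 0, 2] ∘ col) := fun h' =>
  (isNiceThree_tripleMechanism hSP hF hcol).not_middleServed_swap₁₂ h fun a b c hab hbc =>
    (tripleMechanism_swap₁₂ (F := F) col a b c).subst (motive := (HasFacilityAt · b))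
      (h' a b c hab hbc)

lemma CoalitionServed.not_swap₂₃ (hSP : Strategyproof F) (hF : HasApproxRatio F ρ)
    {col : Fin n → Fin 3} (hcol : Function.Surjective col)
    (h : CoalitionServed F col) : ¬ CoalitionServed F (![0, 2, 1] ∘ col) := fun h' =>
  (isNiceThree_tripleMechanism hSP hF hcol).not_middleServed_swap₂₃ h fun a b c hab hbc =>
    (tripleMechanism_swap₂₃ (F := F) col a b c).subst (motive := (HasFacilityAt · b))
      (h' a b c hab hbc)

lemma tripleMechanism_eq_extremes (hSP : Strategyproof F) (hF : HasApproxRatio F ρ)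
    {col : Fin n → Fin 3} (hcol : Function.Surjective col)
    (h : ¬ CoalitionServed F col) {a b c : ℝ} (hab : a < b) (hbc : b < c) :
    tripleMechanism F col a b c = (a, c) :=
  (isNiceThree_tripleMechanism hSP hF hcol).eq_extremes h hab hbc

lemma CoalitionServed.split (hSP : Strategyproof F) (hF : HasApproxRatio F ρ)
    {q : Fin n → Fin 4} (hq : Function.Surjective q)
    (h : CoalitionServed F (![0, 1, 1, 2] ∘ q)) :
    CoalitionServed F (![0, 1, 2, 2] ∘ q) ∨ CoalitionServed F (![0, 0, 1, 2] ∘ q) := by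
  by_contra! hn
  have s1 : Function.Surjective (![0, 1, 2, 2] : Fin 4 → Fin 3) := by decide
  have s2 : Function.Surjective (![0, 0, 1, 2] : Fin 4 → Fin 3) := by decide
  refine (isNiceFour_quadrupleMechanism hSP hF hq).not_middleServed ?_ ?_ ?_
  · intro a b c hab hbc
    rw [← tripleMechanism_merge_right]
    exact tripleMechanism_eq_extremes hSP hF (s1.comp hq) hn.1 hab hbc
  · intro a b c hab hbc
    rw [← tripleMechanism_merge_left]
    exact tripleMechanism_eq_extremes hSP hF (s2.comp hq) hn.2 hab hbc
  · intro a b c hab hbc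
    have h' := h a b c hab hbc
    rwa [tripleMechanism_merge_middle] at h'

/-- Agents on the left of the served coalition may join the right one. -/
lemma CoalitionServed.move_right (hSP : Strategyproof F) (hF : HasApproxRatio F ρ)
    {q : Fin n → Fin 4} (hq : Function.Surjective q)
    (h : CoalitionServed F (![0, 0, 1, 2] ∘ q)) : CoalitionServed F (![0, 2, 1, 2] ∘ q) := by
  have s1 : Function.Surjective (![0, 2, 1, 3] : Fin 4 → Fin 4) := by decide
  have s2 : Function.Surjective (![0, 0, 1, 2] : Fin 4 → Fin 3) := by decide
  have e1 : (![0, 1, 1, 2] : Fin 4 → Fin 3) = ![0, 1, 1, 2] ∘ ![0, 2, 1, 3] := by decide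
  have e2 : (![0, 1, 2, 2] : Fin 4 → Fin 3) ∘ ![0, 2, 1, 3] = ![0, 2, 1, 2] := by decide
  have e3 : (![0, 0, 1, 2] : Fin 4 → Fin 3) ∘ ![0, 2, 1, 3]
    = ![0, 0, 1, 2] ∘ ![1, 2, 0, 3] := by decide
  have e4 : (![0, 1, 1, 2] : Fin 4 → Fin 3) ∘ ![1, 2, 0, 3]
    = ![1, 0, 2] ∘ ![0, 0, 1, 2] := by decide
  -- Groups `1` and `2` together are served. Sending group `1` to the right is the claim. If instead
  -- group `2` went left, group `1` would be served; absorbing group `0` then gives the order of `h`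
  -- with its left and middle coalitions exchanged.
  have h1 := h.absorb_left hSP
  rw [e1, Function.comp_assoc] at h1
  rcases h1.split hSP hF (s1.comp hq) with h2 | h2
  · rwa [← Function.comp_assoc, e2] at h2
  · rw [← Function.comp_assoc, e3, Function.comp_assoc] at h2
    have h3 := h2.absorb_left hSP
    rw [← Function.comp_assoc, e4, Function.comp_assoc] at h3
    exact absurd h3 (h.not_swap₁₂ hSP hF (s2.comp hq))

/-- Agents on the right of the served coalition may join the left one. -/
lemma CoalitionServed.move_left (hSP : Strategyproof F) (hF : HasApproxRatio F ρ)
    {q : Fin n → Fin 4} (hq : Function.Surjective q)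
    (h : CoalitionServed F (![0, 2, 1, 2] ∘ q)) : CoalitionServed F (![0, 0, 1, 2] ∘ q) := by
  have s2 : Function.Surjective (![0, 2, 1, 2] : Fin 4 → Fin 3) := by decide
  have e1 : (![0, 1, 1, 2] : Fin 4 → Fin 3) ∘ ![0, 2, 1, 3] = ![0, 1, 1, 2] := by decide
  have e2 : (![0, 2, 1, 2] : Fin 4 → Fin 3) = ![0, 1, 2, 2] ∘ ![0, 2, 1, 3] := by decide
  have e3 : (![0, 1, 2, 2] : Fin 4 → Fin 3) = ![0, 1, 2, 2] ∘ ![0, 1, 3, 2] := by decide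
  have e4 : (![0, 1, 1, 2] : Fin 4 → Fin 3) ∘ ![0, 1, 3, 2]
    = ![0, 2, 1] ∘ ![0, 2, 1, 2] := by decide
  have h0 := h
  rw [e2, Function.comp_assoc] at h0
  have h1 := h0.absorb_right hSP
  rw [← Function.comp_assoc, e1] at h1
  rcases h1.split hSP hF hq with h2 | h2
  · rw [e3, Function.comp_assoc] at h2
    have h3 := h2.absorb_right hSP
    rw [← Function.comp_assoc, e4, Function.comp_assoc] at h3
    exact absurd h3 (h.not_swap₂₃ hSP hF (s2.comp hq))
  · exact h2

/-- If some coalition is served, then so is a single agent. -/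
lemma CoalitionServed.exists_singleton (hSP : Strategyproof F) (hF : HasApproxRatio F ρ)
    {col : Fin n → Fin 3} (hcol : Function.Surjective col)
    (h : CoalitionServed F col) :
    ∃ (col' : Fin n → Fin 3) (j : Fin n), Function.Surjective col' ∧ CoalitionServed F col' ∧
      ∀ i, col' i = 1 ↔ i = j := by
  induction hk : (Finset.univ.filter fun i => col i = 1).card using Nat.strong_induction_on
    generalizing col with
  | _ k ih =>
    obtain ⟨j, hj⟩ := hcol 1
    by_cases hs : ∀ i, col i = 1 → i = j
    · exact ⟨col, j, hcol, h, fun i => ⟨hs i, fun hi => hi ▸ hj⟩⟩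
    push Not at hs
    obtain ⟨j', hj', hne⟩ := hs
    obtain ⟨i₀, hi₀⟩ := hcol 0
    obtain ⟨i₂, hi₂⟩ := hcol 2
    -- The middle coalition is cut into `j` and the rest, both smaller than the whole.
    set q : Fin n → Fin 4 := fun i =>
      if col i = 0 then 0 else if col i = 2 then 3 else if i = j then 1 else 2 with hqdef
    have hq : Function.Surjective q := by
      intro k
      fin_cases k
      · exact ⟨i₀, by simp [hqdef, hi₀]⟩
      · exact ⟨j, by simp [hqdef, hj]⟩
      · exact ⟨j', by simp [hqdef, hj', hne]⟩
      · exact ⟨i₂, by simp [hqdef, hi₂]⟩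
    have hthree : ∀ i, col i = 0 ∨ col i = 1 ∨ col i = 2 := fun i => by
      generalize col i = k; revert k; decide
    have hcq : col = ![0, 1, 1, 2] ∘ q := by
      ext1 i
      rcases hthree i with h | h | h
      · simp [hqdef, h]
      · by_cases hij : i = j <;> simp [hqdef, h, hij, hj]
      · simp [hqdef, h]
    have s1 : Function.Surjective (![0, 1, 2, 2] : Fin 4 → Fin 3) := by decide
    have s2 : Function.Surjective (![0, 0, 1, 2] : Fin 4 → Fin 3) := by decide
    have hlt : ∀ (f : Fin 4 → Fin 3) (i : Fin n), (∀ k, f k = 1 → k = 1 ∨ k = 2) → col i = 1 →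
        f (q i) ≠ 1 → (Finset.univ.filter fun i => (f ∘ q) i = 1).card < k := by
      intro f i hf hi hfi
      rw [← hk]
      refine Finset.card_lt_card (Finset.ssubset_iff_subset_ne.2 ⟨?_, fun heq => ?_⟩)
      · intro i hi
        simp only [Finset.mem_filter, Finset.mem_univ, true_and, Function.comp_apply] at hi ⊢
        rw [hcq]
        rcases hf _ hi with h | h <;> simp [h]
      · have : i ∈ Finset.univ.filter fun i => (f ∘ q) i = 1 := by
          rw [heq]; simpa using hi
        exact hfi (by simpa using this)
    rw [hcq] at h
    rcases h.split hSP hF hq with h | h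
    · exact ih _ (hlt _ j' (by decide) hj' (by simp [hqdef, hj', hne])) (s1.comp hq) h rfl
    · exact ih _ (hlt _ j (by decide) hj (by simp [hqdef, hj])) (s2.comp hq) h rfl

/-- The agent `j` is between the agents in `S` and the other ones. -/
def isolate (j : Fin n) (S : Finset (Fin n)) : Fin n → Fin 3 := fun i =>
  if i = j then 1 else if i ∈ S then 0 else 2

lemma coalitionServed_isolate_iff (hSP : Strategyproof F) (hF : HasApproxRatio F ρ)
    {j : Fin n} {S T : Finset (Fin n)} (hST : S ⊆ T)
    (hS : ∃ i ∈ S, i ≠ j) (hT : ∃ i ∉ T, i ≠ j) :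
    CoalitionServed F (isolate j S) ↔ CoalitionServed F (isolate j T) := by
  by_cases hne : ∃ i ∈ T, i ∉ S ∧ i ≠ j
  · obtain ⟨i₀, h0, h0'⟩ := hS
    obtain ⟨i₁, h1, h1', h1''⟩ := hne
    obtain ⟨i₃, h3, h3'⟩ := hT
    have h3S : i₃ ∉ S := fun h => h3 (hST h)
    set q : Fin n → Fin 4 := fun i =>
      if i = j then 2 else if i ∈ S then 0 else if i ∈ T then 1 else 3 with hqdef
    have hq : Function.Surjective q := by
      intro k
      fin_cases k
      · exact ⟨i₀, by simp [hqdef, h0, h0']⟩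
      · exact ⟨i₁, by simp [hqdef, h1, h1', h1'']⟩
      · exact ⟨j, by simp [hqdef]⟩
      · exact ⟨i₃, by simp [hqdef, h3, h3', h3S]⟩
    have eS : isolate j S = ![0, 2, 1, 2] ∘ q := by
      ext1 i
      by_cases h : i = j
      · simp [hqdef, isolate, h]
      · by_cases h' : i ∈ S
        · simp [hqdef, isolate, h, h']
        · by_cases h'' : i ∈ T <;> simp [hqdef, isolate, h, h', h'']
    have eT : isolate j T = ![0, 0, 1, 2] ∘ q := by
      ext1 i
      by_cases h : i = j
      · simp [hqdef, isolate, h]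
      · by_cases h' : i ∈ S
        · simp [hqdef, isolate, h, h', hST h']
        · by_cases h'' : i ∈ T <;> simp [hqdef, isolate, h, h', h'']
    rw [eS, eT]
    exact ⟨fun h => h.move_left hSP hF hq, fun h => h.move_right hSP hF hq⟩
  · push Not at hne
    have : isolate j S = isolate j T := by
      ext1 i
      by_cases h : i = j
      · simp [isolate, h]
      · by_cases h' : i ∈ S
        · simp [isolate, h, h', hST h']
        · have h'' : i ∉ T := fun hT => h (hne i hT h')
          simp [isolate, h, h', h'']
    rw [this]

/-- If an agent is served between two groups of at least three other agents in total, then she is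
served between any two groups. -/
lemma CoalitionServed.isolate (hSP : Strategyproof F) (hF : HasApproxRatio F ρ)
    (hn : 4 ≤ n) {j : Fin n} {S S' : Finset (Fin n)}
    (hS : ∃ i ∈ S, i ≠ j) (hS' : ∃ i ∉ S, i ≠ j) (hT : ∃ i ∈ S', i ≠ j) (hT' : ∃ i ∉ S', i ≠ j)
    (h : CoalitionServed F (isolate j S)) :
    CoalitionServed F (FacilityLocation.isolate j S') := by
  have hthird : ∀ x y : Fin n, ∃ k, k ≠ j ∧ k ≠ x ∧ k ≠ y := by
    intro x y
    obtain ⟨k, hk⟩ := Finset.exists_mem_notMem_of_card_lt_card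
      (s := {j, x, y}) (t := (Finset.univ : Finset (Fin n)))
      (lt_of_le_of_lt Finset.card_le_three (by simp; lia))
    refine ⟨k, ?_⟩
    simpa using hk
  obtain ⟨x, hxS, hx⟩ := hS
  obtain ⟨y, hyS, hy⟩ := hT
  obtain ⟨k, hk, hkx, hky⟩ := hthird x y
  -- The sets `S`, `{x}`, `{x, y}`, `{y}`, `S'` are consecutively nested; the fourth agent `k` keeps
  -- the right side of `{x, y}` occupied.
  have h1 : CoalitionServed F (FacilityLocation.isolate j {x}) :=
    (coalitionServed_isolate_iff hSP hF (by simpa using hxS) ⟨x, by simp, hx⟩ hS').2 h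
  have h2 : CoalitionServed F (FacilityLocation.isolate j {x, y}) :=
    (coalitionServed_isolate_iff hSP hF (by simp) ⟨x, by simp, hx⟩
      ⟨k, by simp [hkx, hky], hk⟩).1 h1
  have h3 : CoalitionServed F (FacilityLocation.isolate j {y}) :=
    (coalitionServed_isolate_iff hSP hF (by simp) ⟨y, by simp, hy⟩
      ⟨k, by simp [hkx, hky], hk⟩).2 h2
  exact (coalitionServed_isolate_iff hSP hF (by simpa using hyS) ⟨y, by simp, hy⟩ hT').1 h3

/-- If some coalition is served, then there is an agent such that every coalition containing her
is served. -/
lemma CoalitionServed.exists_dictator (hSP : Strategyproof F) (hF : HasApproxRatio F ρ)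
    (hn : 4 ≤ n) {col : Fin n → Fin 3}
    (hcol : Function.Surjective col) (h : CoalitionServed F col) :
    ∃ j, ∀ col' : Fin n → Fin 3, Function.Surjective col' → col' j = 1 →
      CoalitionServed F col' := by
  obtain ⟨col₀, j, hcol₀, h₀, hj⟩ := h.exists_singleton hSP hF hcol
  have hthree : ∀ k : Fin 3, k = 0 ∨ k = 1 ∨ k = 2 := by decide
  have hvalid : ∀ col' : Fin n → Fin 3, Function.Surjective col' → col' j = 1 →
      (∃ i ∈ Finset.univ.filter fun i => col' i ≠ 2, i ≠ j) ∧
      (∃ i ∉ Finset.univ.filter fun i => col' i ≠ 2, i ≠ j) := by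
    intro col' hcol' hj'
    obtain ⟨i₀, hi₀⟩ := hcol' 0
    obtain ⟨i₂, hi₂⟩ := hcol' 2
    refine ⟨⟨i₀, by simp [hi₀], ?_⟩, ⟨i₂, by simp [hi₂], ?_⟩⟩
    · rintro rfl; simp [hj'] at hi₀
    · rintro rfl; simp [hj'] at hi₂
  have e₀ : col₀ = FacilityLocation.isolate j (Finset.univ.filter fun i => col₀ i ≠ 2) := by
    ext1 i
    by_cases hi : i = j
    · simp [FacilityLocation.isolate, hi, (hj j).2 rfl]
    · have hne : col₀ i ≠ 1 := fun h => hi ((hj i).1 h)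
      rcases hthree (col₀ i) with h | h | h
      · simp [FacilityLocation.isolate, hi, h]
      · exact absurd h hne
      · simp [FacilityLocation.isolate, hi, h]
  refine ⟨j, fun col' hcol' hj' => ?_⟩
  have v₀ := hvalid col₀ hcol₀ ((hj j).2 rfl)
  have v := hvalid col' hcol' hj'
  rw [e₀] at h₀
  have h1 := h₀.isolate hSP hF hn v₀.1 v₀.2 v.1 v.2
  -- The companions of `j` in the middle form group `1`: they start on the left and are absorbed at
  -- the end.
  set q : Fin n → Fin 4 := fun i =>
    if i = j then 2 else if col' i = 0 then 0 else if col' i = 1 then 1 else 3 with hqdef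
  have e1 : FacilityLocation.isolate j (Finset.univ.filter fun i => col' i ≠ 2)
      = ![0, 0, 1, 2] ∘ q := by
    ext1 i
    by_cases hi : i = j
    · simp [FacilityLocation.isolate, hqdef, hi]
    · rcases hthree (col' i) with h | h | h <;> simp [FacilityLocation.isolate, hqdef, hi, h]
  have e2 : col' = ![0, 1, 1, 2] ∘ q := by
    ext1 i
    by_cases hi : i = j
    · simp [hqdef, hi, hj']
    · rcases hthree (col' i) with h | h | h <;> simp [hqdef, hi, h]
  rw [e1] at h1
  rw [e2]
  exact h1.absorb_left hSP

/-! ### Three-location instances and the dichotomy -/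

lemma exists_coalitions {x : Instance n} (hx : x ∈ threeLocationInstances n) :
    ∃ (a b c : ℝ) (col : Fin n → Fin 3), a < b ∧ b < c ∧ Function.Surjective col ∧
      x = ![a, b, c] ∘ col := by
  have key : ∀ a b c : ℝ, a < b → b < c → Set.range x = {a, b, c} →
      ∃ (a b c : ℝ) (col : Fin n → Fin 3), a < b ∧ b < c ∧ Function.Surjective col ∧
        x = ![a, b, c] ∘ col := by
    intro a b c hab hbc hr
    refine ⟨a, b, c, fun i => if x i = a then 0 else if x i = b then 1 else 2, hab, hbc, ?_, ?_⟩
    · intro k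
      have ha : a ∈ Set.range x := by simp [hr]
      have hb : b ∈ Set.range x := by simp [hr]
      have hc : c ∈ Set.range x := by simp [hr]
      obtain ⟨i, hi⟩ := ha
      obtain ⟨i', hi'⟩ := hb
      obtain ⟨i'', hi''⟩ := hc
      fin_cases k
      · exact ⟨i, by simp [hi]⟩
      · exact ⟨i', by simp [hi', hab.ne']⟩
      · exact ⟨i'', by simp [hi'', hbc.ne', (hab.trans hbc).ne']⟩
    · ext i
      have hi : x i ∈ ({a, b, c} : Set ℝ) := hr ▸ Set.mem_range_self i
      rcases hi with h | h | h
      · simp [h]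
      · simp [h, hab.ne']
      · have h : x i = c := h
        simp [h, hbc.ne', (hab.trans hbc).ne']
  obtain ⟨a, b, c, hab, hac, hbc, hr⟩ := hx
  rcases hab.lt_or_gt with h1 | h1 <;> rcases hac.lt_or_gt with h2 | h2 <;>
    rcases hbc.lt_or_gt with h3 | h3
  · exact key a b c h1 h3 hr
  · exact key a c b h2 h3 (by rw [hr]; ext; simp; tauto)
  · linarith
  · exact key c a b h2 h1 (by rw [hr]; ext; simp; tauto)
  · exact key b a c h1 h2 (by rw [hr]; ext; simp; tauto)
  · linarith
  · exact key b c a h3 h2 (by rw [hr]; ext; simp; tauto)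
  · exact key c b a h3 h1 (by rw [hr]; ext; simp; tauto)

lemma comp_mem_threeLocationInstances {a b c : ℝ} (hab : a < b) (hbc : b < c)
    {col : Fin n → Fin 3} (hcol : Function.Surjective col) :
    (![a, b, c] ∘ col : Instance n) ∈ threeLocationInstances n := by
  refine ⟨a, b, c, hab.ne, (hab.trans hbc).ne, hbc.ne, ?_⟩
  rw [hcol.range_comp]
  ext y
  simp [eq_comm]
  tauto

lemma coalitionServed_of_dictator {j : Fin n}
    (hj : ∀ x ∈ threeLocationInstances n, HasFacilityAt (F.outcome x) (x j))
    {col : Fin n → Fin 3} (hcol : Function.Surjective col) (h : col j = 1) :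
    CoalitionServed F col := by
  intro a b c hab hbc
  have := hj _ (comp_mem_threeLocationInstances hab hbc hcol)
  simpa [h, tripleMechanism] using this

/-- On the instances with three locations, a nice mechanism for at least four agents has a unique
dictator, or it places the facilities at the two extremes. -/
theorem Nice.existsUnique_dictator_or_extremes (hn : 4 ≤ n) (hF : Nice F) :
    (∃! j : Fin n, ∀ x ∈ threeLocationInstances n, HasFacilityAt (F.outcome x) (x j)) ∨
      (∀ x ∈ threeLocationInstances n, F.outcome x = (⨅ i, x i, ⨆ i, x i)) := by
  obtain ⟨hSP, ρ, hρ⟩ := hF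
  by_cases hex : ∃ col : Fin n → Fin 3, Function.Surjective col ∧ CoalitionServed F col
  · left
    obtain ⟨col₀, hcol₀, h₀⟩ := hex
    obtain ⟨j, hj⟩ := h₀.exists_dictator hSP hρ hn hcol₀
    have s₁₂ : Function.Surjective (![1, 0, 2] : Fin 3 → Fin 3) := by decide
    have s₂₃ : Function.Surjective (![0, 2, 1] : Fin 3 → Fin 3) := by decide
    refine ⟨j, ?_, ?_⟩
    · intro x hx
      obtain ⟨a, b, c, col, hab, hbc, hcol, rfl⟩ := exists_coalitions hx
      have hthree : ∀ k : Fin 3, k = 0 ∨ k = 1 ∨ k = 2 := by decide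
      rcases hthree (col j) with h | h | h
      -- With `j` at the left end, the exchanged order has her in the middle and served; so the
      -- given order does not serve its middle, and both extremes get facilities.
      · have hs := hj (![1, 0, 2] ∘ col) (s₁₂.comp hcol) (by simp [h])
        have he := tripleMechanism_eq_extremes hSP hρ hcol
          (fun hs' => hs'.not_swap₁₂ hSP hρ hcol hs) hab hbc
        rw [tripleMechanism] at he
        rw [he]
        exact Or.inl (by simp [h])
      · have hs := hj col hcol h a b c hab hbc
        simpa [h, tripleMechanism] using hs
      · have hs := hj (![0, 2, 1] ∘ col) (s₂₃.comp hcol) (by simp [h])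
        have he := tripleMechanism_eq_extremes hSP hρ hcol
          (fun hs' => hs'.not_swap₂₃ hSP hρ hcol hs) hab hbc
        rw [tripleMechanism] at he
        rw [he]
        exact Or.inr (by simp [h])
    · intro j' hj'
      by_contra hne
      obtain ⟨k, hk⟩ := Finset.exists_mem_notMem_of_card_lt_card
        (s := {j, j'}) (t := (Finset.univ : Finset (Fin n)))
        (lt_of_le_of_lt Finset.card_le_two (by simp; linarith))
      simp only [Finset.mem_univ, Finset.mem_insert, Finset.mem_singleton, not_or,
        true_and] at hk
      have hcol : Function.Surjective
          (fun i => if i = j then 0 else if i = j' then 1 else 2 : Fin n → Fin 3) := by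
        intro l
        fin_cases l
        · exact ⟨j, by simp⟩
        · exact ⟨j', by simp [hne]⟩
        · exact ⟨k, by simp [hk.1, hk.2]⟩
      exact (coalitionServed_of_dictator hj' hcol (by simp [hne])).not_swap₁₂ hSP hρ hcol
        (hj _ (s₁₂.comp hcol) (by simp))
  · right
    push Not at hex
    intro x hx
    obtain ⟨a, b, c, col, hab, hbc, hcol, rfl⟩ := exists_coalitions hx
    have he := tripleMechanism_eq_extremes hSP hρ hcol (hex col hcol) hab hbc
    rw [tripleMechanism] at he
    rw [he]
    have hle : ∀ k, a ≤ ![a, b, c] k ∧ ![a, b, c] k ≤ c := by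
      intro k
      fin_cases k <;> simp <;> (try constructor) <;> linarith
    obtain ⟨i₀, hi₀⟩ := hcol 0
    obtain ⟨i₂, hi₂⟩ := hcol 2
    have : Nonempty (Fin n) := ⟨i₀⟩
    refine Prod.ext (le_antisymm (le_ciInf fun i => (hle (col i)).1) ?_)
      (le_antisymm ?_ (ciSup_le fun i => (hle (col i)).2))
    · refine (ciInf_le (Set.finite_range _).bddBelow i₀).trans ?_
      simp [hi₀]
    · refine le_trans ?_ (le_ciSup (Set.finite_range _).bddAbove i₂)
      simp [hi₂]

end FacilityLocation

theorem theorem3 (n : ℕ) (hn : 5 ≤ n) (F : FacilityLocation.Mechanism n)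
    (hF : FacilityLocation.Nice F) :
    (∃! j : Fin n, ∀ x ∈ FacilityLocation.threeLocationInstances n,
        FacilityLocation.HasFacilityAt (F.outcome x) (x j)) ∨
      (∀ x ∈ FacilityLocation.threeLocationInstances n,
        F.outcome x = (⨅ i, x i, ⨆ i, x i)) := by
  exact hF.existsUnique_dictator_or_extremes (by lia)
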